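/- **Setting.** Let $d\ge 1$ and $0<s\le 2$, and let $C,C',C'',\varepsilon,c,c',c'',a,a',M>0$. Assume: * (kernel) $K_0:\mathbb R\to[0,\infty)$ satisfies $K_0\le C$, $\int K_0=1$, $\int xK_0(x)\,dx=0$, $\int x^2K_0(x)\,dx\le C'$ and $|K_0(y)-K_0(x)|\le C''|x-y|^{\varepsilon}$ for all $x,y$; put $K(x)=\prod_{i=1}^d K_0(x_i)$ for $x\in\mathbb R^d$; * (target) $f$ is a probability density on $\mathbb R^d$ with $f(x)\le c\,e^{-c'\|x\|_2^2}$ and $|f(x+u)-f(x)-\langle\nabla f(x),u\rangle\mathbf 1\{s>1\}|\le c''\|u\|_2^{s}$ for all $x,u\in\mathbb R^d$; * (initial proposal) $g$ is a probability density on $\mathbb R^d$ with $f\le Mg$ and $g(x)\le a\,e^{-a'\|x\|_2^2}$ for all $x\in\mathbb R^d$. Put $v=\frac{2}{\min(1,s)}\log\left(1+\frac1{c''+c}\right)+\frac3\varepsilon\log\left(1+\frac1{C''c}\right)$ and $H_1=8d(v+1)\left(2\sqrt{cC^d}+c''(1+C')d+C^d\right)$, and let $H_E>0$ with $H_E\ge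 H_1$. **Algorithm** (extended pliable rejection sampling; budget of $n$ calls to $f$; $\delta\in(0,1)$). Let $T_s=\lceil n^{(2s+d)/(3s+d)}\rceil$ and $\bar N=T_s/M-2\sqrt{T_s\log(1/\delta)}$. Let $B(\rho)$ be the centred ball of radius $\rho$ in $\mathbb R^d$, and let $\mathcal V_n$ be the volume of $B(\log n)$. Put $$r=\mathcal V_nH_E\left(\frac{\log(\bar N/\delta)}{\bar N}\right)^{\frac{s}{2s+d}},\qquad \bar g=\int_{B(\log\bar N)^c}g(x)\,dx,\qquad W=1+r+M\bar g .$$ 1. Draw $T_s$ points independently from $g$ and accept each point $X$ with probability $f(X)/(Mg(X))$. Let $X_1,\dots,X_{\hat N}$ be the accepted points, $h=\left(\log(\hat N/\delta)/\hat N\right)^{1/(2s+d)}$ and $$\tilde f(x)=\mathbf 1\{\|x\|_2\le\log\hat N\}\,\frac1{\hat Nh^d}\sum_{k=1}^{\hat N}K\left(\frac{X_k-x}{h}\right).$$ 2. Let $\hat g^\star(x)=\frac1W\left(\tilde f(x)+\frac{r}{\mathcal V_n}\mathbf 1\{x\in B(\log n)\}+Mg(x)\mathbf 1\{\|x\|_2\ge\log\bar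 N\}\right)$. Given the first stage, draw $n-T_s$ points independently from the probability distribution proportional to $\hat g^\star$, and accept each point $Y$ with probability $\min\{1,f(Y)/(W\hat g^\star(Y))\}$. Output the $\hat n$ accepted points. **Theorem.** There is a constant $\kappa>0$, depending only on $d,s,C,C',C'',\varepsilon,c,c',c'',a,a',M,H_E$, such that for every $\delta\in(0,1)$ there is $n_0$, depending only on these constants and on $\delta$, such that for all $n\ge n_0$ and all $K_0,f,g$ as above there is an event $G$, determined by the first stage, with the following two properties. * Given any first-stage outcome in $G$, the output is i.i.d. with density $f$: for every $k$, conditionally on $\hat n=k$, the $k$ returned points, in the order in which they were drawn, are independent with density $f$. * With probability at least $1-\delta$, the event $G$ occurs and $$\hat n\ \ge\ n\left[1-\kappa\,\log(n/\delta)^{d+1}\,n^{-\frac{s}{3s+d}}\right].$$ -/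

import Mathlib

open MeasureTheory

noncomputable section

namespace EPRS

/-! ## Assumptions -/

/-- Assumption on the univariate kernel `K₀`: a density bounded by `C`, centred, with second moment
at most `C'`, and `ε`-Hölder with constant `C''`. -/
structure KernelAssumption (K₀ : ℝ → ℝ) (C C' C'' ε : ℝ) : Prop where
  nonneg : ∀ x, 0 ≤ K₀ x
  le_bound : ∀ x, K₀ x ≤ C
  integral_eq_one : ∫ x, K₀ x = 1
  integral_mul_eq_zero : ∫ x, x * K₀ x = 0
  integrable_sq_mul : Integrable fun x => x ^ 2 * K₀ x
  integral_sq_mul_le : ∫ x, x ^ 2 * K₀ x ≤ C'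
  holder : ∀ x y, |K₀ y - K₀ x| ≤ C'' * |x - y| ^ ε

/-- `f` is a probability density with respect to Lebesgue measure on `ℝ^d`. -/
structure IsDensity {d : ℕ} (f : EuclideanSpace ℝ (Fin d) → ℝ) : Prop where
  measurable : Measurable f
  nonneg : ∀ x, 0 ≤ f x
  integral_eq_one : ∫ x, f x = 1

/-- Assumption on the target: a sub-Gaussian density with a uniform Taylor expansion of order `s`.
For `1 < s` the inequality forces `f` to be differentiable, whatever value `gradient f x` has at
points where this is not known beforehand. -/
structure TargetAssumption {d : ℕ} (f : EuclideanSpace ℝ (Fin d) → ℝ) (s c c' c'' : ℝ) : Prop where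
  isDensity : IsDensity f
  subGaussian : ∀ x, f x ≤ c * Real.exp (-c' * ‖x‖ ^ 2)
  taylor : ∀ x u, |f (x + u) - f x - (if 1 < s then inner ℝ (gradient f x) u else 0)|
    ≤ c'' * ‖u‖ ^ s

/-- Assumption on the initial proposal: a sub-Gaussian density `g` with `f ≤ M g`. -/
structure ProposalAssumption {d : ℕ} (f g : EuclideanSpace ℝ (Fin d) → ℝ) (M a a' : ℝ) :
    Prop where
  isDensity : IsDensity g
  le_mul : ∀ x, f x ≤ M * g x
  subGaussian : ∀ x, g x ≤ a * Real.exp (-a' * ‖x‖ ^ 2)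

/-! ## Constants -/

/-- The exponent `v` that enters the constant of the uniform kernel density bound. -/
def vConst (s ε c c'' C'' : ℝ) : ℝ :=
  Real.log (1 + 1 / (c'' + c)) * (2 / min 1 s) + 3 / ε * Real.log (1 + 1 / (C'' * c))

/-- The constant `H₁` of the uniform kernel density bound. -/
def H₁ (d : ℕ) (s ε c c'' C C' C'' : ℝ) : ℝ :=
  8 * d * (vConst s ε c c'' C'' + 1) * (2 * √(c * C ^ d) + c'' * (1 + C') * d + C ^ d)

/-- `T_s`: number of calls to `f` in the initial stage. -/
def initCalls (d : ℕ) (s : ℝ) (n : ℕ) : ℕ :=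
  ⌈(n : ℝ) ^ ((2 * s + d) / (3 * s + d))⌉₊

/-- `N̄`: the high-probability lower bound on the number of samples of the initial stage. -/
def Nbar (d : ℕ) (s M δ : ℝ) (n : ℕ) : ℝ :=
  initCalls d s n / M - 2 * √(initCalls d s n * Real.log (1 / δ))

/-- `𝒱_n`: the volume of the centred ball of radius `log n` of `ℝ^d`. -/
def ballVol (d n : ℕ) : ℝ :=
  volume.real (Metric.closedBall (0 : EuclideanSpace ℝ (Fin d)) (Real.log n))

/-- `r_N̄`. -/
def rBar (d : ℕ) (s M δ H : ℝ) (n : ℕ) : ℝ :=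
  ballVol d n * H * (Real.log (Nbar d s M δ n / δ) / Nbar d s M δ n) ^ (s / (2 * s + d))

/-- `ḡ_N̄`: the mass of `g` outside the centred ball of radius `log N̄`. -/
def gBar {d : ℕ} (g : EuclideanSpace ℝ (Fin d) → ℝ) (s M δ : ℝ) (n : ℕ) : ℝ :=
  ∫ x in (Metric.closedBall (0 : EuclideanSpace ℝ (Fin d)) (Real.log (Nbar d s M δ n)))ᶜ, g x

/-- The normalisation, and rejection constant of the second stage: `1 + r_N̄ + M ḡ_N̄`. -/
def rejConst {d : ℕ} (g : EuclideanSpace ℝ (Fin d) → ℝ) (s M δ H : ℝ) (n : ℕ) : ℝ :=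
  1 + rBar d s M δ H n + M * gBar g s M δ n

/-! ## Rejection sampling -/

/-- The measure with density `f` with respect to Lebesgue measure. -/
def densityMeasure {d : ℕ} (f : EuclideanSpace ℝ (Fin d) → ℝ) :
    Measure (EuclideanSpace ℝ (Fin d)) :=
  volume.withDensity fun x => ENNReal.ofReal (f x)

/-- The probability distribution proportional to `q`. -/
def normalizedLaw {d : ℕ} (q : EuclideanSpace ℝ (Fin d) → ℝ) :
    Measure (EuclideanSpace ℝ (Fin d)) :=
  (densityMeasure q Set.univ)⁻¹ • densityMeasure q

/-- Law of `m` independent pairs (proposed point, uniform variable on `[0,1]`), the points being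
drawn from the distribution proportional to `q`. -/
def drawLaw {d : ℕ} (m : ℕ) (q : EuclideanSpace ℝ (Fin d) → ℝ) :
    Measure (Fin m → EuclideanSpace ℝ (Fin d) × ℝ) :=
  Measure.pi fun _ => (normalizedLaw q).prod (volume.restrict (Set.Icc 0 1))

open Classical in
/-- Rejection sampling towards `f` with envelope `e`: the point `x` with uniform variable `u` is
accepted when `u * e x ≤ f x`. Returns the set of the indices of the accepted points. -/
def accepted {d m : ℕ} (f e : EuclideanSpace ℝ (Fin d) → ℝ)
    (y : Fin m → EuclideanSpace ℝ (Fin d) × ℝ) : Finset (Fin m) :=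
  Finset.univ.filter fun i => (y i).2 * e (y i).1 ≤ f (y i).1

/-- The accepted points, in the order in which they were proposed, on the event that there are
`k` of them. -/
def output {d m k : ℕ} (f e : EuclideanSpace ℝ (Fin d) → ℝ)
    (y : Fin m → EuclideanSpace ℝ (Fin d) × ℝ) (h : (accepted f e y).card = k) :
    Fin k → EuclideanSpace ℝ (Fin d) :=
  fun i => (y ((accepted f e y).orderEmbOfFin h i)).1

/-- When the pairs have law `P`, the accepted points are i.i.d. with density `f`: given that their
number is `k`, for any `k`, their joint law is the `k`-fold product of the law with density `f`. -/
def OutputIID {d m : ℕ} (P : Measure (Fin m → EuclideanSpace ℝ (Fin d) × ℝ))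
    (f e : EuclideanSpace ℝ (Fin d) → ℝ) : Prop :=
  ∀ (k : ℕ) (B : Set (Fin k → EuclideanSpace ℝ (Fin d))), MeasurableSet B →
    P {y | ∃ h : (accepted f e y).card = k, output f e y h ∈ B} =
      P {y | (accepted f e y).card = k} * Measure.pi (fun _ : Fin k => densityMeasure f) B

/-! ## The algorithm -/

/-- The bandwidth `h` for `N` samples. -/
def bandwidth (d : ℕ) (s δ : ℝ) (N : ℕ) : ℝ :=
  (Real.log (N / δ) / N) ^ (1 / (2 * s + d))

/-- The estimate `f̃`: the kernel density estimate built on the `N̂` points of the initial stage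
accepted by rejection sampling with envelope `M g`, set to `0` outside the centred ball of radius
`log N̂`. -/
def fTilde {d T : ℕ} (K₀ : ℝ → ℝ) (f g : EuclideanSpace ℝ (Fin d) → ℝ) (s M δ : ℝ)
    (w : Fin T → EuclideanSpace ℝ (Fin d) × ℝ) (x : EuclideanSpace ℝ (Fin d)) : ℝ :=
  let S := accepted f (fun z => M * g z) w
  let h := bandwidth d s δ S.card
  if ‖x‖ ≤ Real.log S.card then
    1 / (S.card * h ^ d) * ∑ k ∈ S, ∏ i, K₀ (((w k).1 i - x i) / h)
  else 0

open Classical in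
/-- The pliable proposal `ĝ⋆`, given the outcome `w` of the initial stage. -/
def pliable {d T : ℕ} (K₀ : ℝ → ℝ) (f g : EuclideanSpace ℝ (Fin d) → ℝ) (s M δ H : ℝ) (n : ℕ)
    (w : Fin T → EuclideanSpace ℝ (Fin d) × ℝ) (x : EuclideanSpace ℝ (Fin d)) : ℝ :=
  1 / rejConst g s M δ H n *
    (fTilde K₀ f g s M δ w x
      + rBar d s M δ H n *
        (if x ∈ Metric.closedBall 0 (Real.log n) then 1 / ballVol d n else 0)
      + if Real.log (Nbar d s M δ n) ≤ ‖x‖ then M * g x else 0)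

/-- The envelope of the second stage: rejection constant times pliable proposal. -/
def envelope {d T : ℕ} (K₀ : ℝ → ℝ) (f g : EuclideanSpace ℝ (Fin d) → ℝ) (s M δ H : ℝ) (n : ℕ)
    (w : Fin T → EuclideanSpace ℝ (Fin d) × ℝ) (x : EuclideanSpace ℝ (Fin d)) : ℝ :=
  rejConst g s M δ H n * pliable K₀ f g s M δ H n w x

/-- Law of the initial stage: `T_s` draws from `g`. -/
def stageOneLaw {d : ℕ} (g : EuclideanSpace ℝ (Fin d) → ℝ) (s : ℝ) (n : ℕ) :
    Measure (Fin (initCalls d s n) → EuclideanSpace ℝ (Fin d) × ℝ) :=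
  drawLaw (initCalls d s n) g

/-- Conditional law of the second stage given the outcome `w` of the initial stage: `n - T_s`
draws from the pliable proposal built on `w`. -/
def stageTwoLaw {d : ℕ} (K₀ : ℝ → ℝ) (f g : EuclideanSpace ℝ (Fin d) → ℝ) (s M δ H : ℝ) (n : ℕ)
    (w : Fin (initCalls d s n) → EuclideanSpace ℝ (Fin d) × ℝ) :
    Measure (Fin (n - initCalls d s n) → EuclideanSpace ℝ (Fin d) × ℝ) :=
  drawLaw (n - initCalls d s n) (pliable K₀ f g s M δ H n w)

/-- Joint law of the two stages of a run with a budget of `n` calls to `f`. -/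
def runLaw {d : ℕ} (K₀ : ℝ → ℝ) (f g : EuclideanSpace ℝ (Fin d) → ℝ) (s M δ H : ℝ) (n : ℕ) :
    Measure ((Fin (initCalls d s n) → EuclideanSpace ℝ (Fin d) × ℝ) ×
      (Fin (n - initCalls d s n) → EuclideanSpace ℝ (Fin d) × ℝ)) :=
  (stageOneLaw g s n).bind fun w =>
    (stageTwoLaw K₀ f g s M δ H n w).map fun y => (w, y)

/-- `n̂`: the number of samples returned by a run, i.e. accepted in the second stage. -/
def numOutput {d : ℕ} (K₀ : ℝ → ℝ) (f g : EuclideanSpace ℝ (Fin d) → ℝ) (s M δ H : ℝ) (n : ℕ)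
    (ω : (Fin (initCalls d s n) → EuclideanSpace ℝ (Fin d) × ℝ) ×
      (Fin (n - initCalls d s n) → EuclideanSpace ℝ (Fin d) × ℝ)) : ℕ :=
  (accepted f (envelope K₀ f g s M δ H n ω.1) ω.2).card

end EPRS

end

/-!
Rejection sampling with an envelope above `f` returns i.i.d. points with density `f`, and it accepts
each draw with probability one over the mass of the envelope, so only the envelope `W ĝ⋆` matters.

It dominates `f`. Given their number, the points accepted in the initial stage are i.i.d. with
density `f`, hence Bernstein's inequality on two nested nets, with the Hölder continuity of
the kernel between net points and a bias of order `h ^ s`, bounds `f - f̃` by `r / 𝒱_n` on the ball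
of radius `log N̄`, with high probability. Outside this ball `f ≤ M g`.

It wastes little. Its mass is at most `W`, and the sub-Gaussian tails of `g` make `ḡ` of order
`1 / N̄`, so that `W = 1 + O(log (n / δ) ^ (d + 1) * n ^ (-s / (3 * s + d)))`. The cost `T_s` of the
initial stage and the fluctuations of the number of accepted points, which Hoeffding's inequality
controls, are of the same order relative to `n`.
-/

noncomputable section

namespace EPRS

open ProbabilityTheory Filter Topology

/-! ### Tail bounds for i.i.d. sums -/

section Concentration

variable {Ω ι : Type*} [Fintype ι]

open Classical in
/-- The indices of the draws `y` that fall into `A`. -/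
def successes (A : Set Ω) (y : ι → Ω) : Finset ι :=
  Finset.univ.filter fun i => y i ∈ A

theorem mem_successes {A : Set Ω} {y : ι → Ω} {i : ι} : i ∈ successes A y ↔ y i ∈ A := by
  simp [successes]

variable [MeasurableSpace Ω] {μ : Measure Ω} [IsProbabilityMeasure μ]

theorem exp_le_one_add_add_sq {x : ℝ} (hx : x ≤ 1) : Real.exp x ≤ 1 + x + x ^ 2 := by
  rcases le_total (-1) x with h | h
  · linarith [(abs_le.1 (Real.abs_exp_sub_one_sub_id_le (abs_le.2 ⟨h, hx⟩))).2]
  · nlinarith [Real.exp_le_one_iff.2 (h.trans (by norm_num))]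

theorem mgf_le_exp_of_integral_sq_le {Y : Ω → ℝ} (hY : MemLp Y 2 μ) {b v l : ℝ}
    (hb : ∀ᵐ x ∂μ, Y x ≤ b) (hmean : μ[Y] = 0) (hvar : ∫ x, Y x ^ 2 ∂μ ≤ v) (hl : 0 ≤ l)
    (hlb : l * b ≤ 1) : mgf Y μ l ≤ Real.exp (l ^ 2 * v) := by
  have hY₁ : Integrable Y μ := hY.integrable one_le_two
  have hlin : Integrable (fun x => 1 + l * Y x) μ := (integrable_const _).add (hY₁.const_mul l)
  have hquad : Integrable (fun x => l ^ 2 * Y x ^ 2) μ := hY.integrable_sq.const_mul _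
  calc mgf Y μ l ≤ ∫ x, (1 + l * Y x + l ^ 2 * Y x ^ 2) ∂μ := by
        refine integral_mono_ae
          (integrable_exp_mul_of_le l b hl hY.aestronglyMeasurable.aemeasurable hb)
          (hlin.add hquad) ?_
        filter_upwards [hb] with x hx
        simpa only [mul_pow] using
          exp_le_one_add_add_sq ((mul_le_mul_of_nonneg_left hx hl).trans hlb)
    _ = 1 + l ^ 2 * ∫ x, Y x ^ 2 ∂μ := by
        rw [integral_add hlin hquad, integral_add (integrable_const _) (hY₁.const_mul l),
          integral_const_mul, integral_const_mul, hmean]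
        simp
    _ ≤ l ^ 2 * v + 1 := by nlinarith [sq_nonneg l]
    _ ≤ Real.exp (l ^ 2 * v) := Real.add_one_le_exp _

/-- A Bernstein inequality, with the parameter `l` of the Chernoff bound left free. -/
theorem measureReal_pi_sum_ge_le {Y : Ω → ℝ} (hY : MemLp Y 2 μ) {b v l : ℝ}
    (hb : ∀ᵐ x ∂μ, Y x ≤ b) (hmean : μ[Y] = 0) (hvar : ∫ x, Y x ^ 2 ∂μ ≤ v) (hl : 0 ≤ l)
    (hlb : l * b ≤ 1) (t : ℝ) :
    (Measure.pi fun _ : ι => μ).real {x | t ≤ ∑ i, Y (x i)} ≤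
      Real.exp (Fintype.card ι * (l ^ 2 * v) - l * t) := by
  have hYm : AEMeasurable Y μ := hY.aestronglyMeasurable.aemeasurable
  have hindep : iIndepFun (fun (i : ι) x => Y (x i)) (Measure.pi fun _ : ι => μ) :=
    iIndepFun_pi fun _ => hYm
  have heval (i : ι) := measurePreserving_eval (fun _ : ι => μ) i
  have hcoord (i : ι) : AEMeasurable (fun x : ι → Ω => Y (x i)) (Measure.pi fun _ => μ) :=
    hYm.comp_quasiMeasurePreserving (heval i).quasiMeasurePreserving
  have hint : Integrable (fun x => Real.exp (l * Y x)) μ := integrable_exp_mul_of_le l b hl hYm hb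
  have hmgf (i : ι) : mgf (fun x => Y (x i)) (Measure.pi fun _ => μ) l = mgf Y μ l := by
    have := mgf_map (X := Y) (t := l) (measurable_pi_apply i).aemeasurable
      ((heval i).map_eq.symm ▸ hint.aestronglyMeasurable)
    rw [(heval i).map_eq] at this
    exact this.symm
  have hint_sum : Integrable (fun x : ι → Ω => Real.exp (l * ∑ i, Y (x i)))
      (Measure.pi fun _ => μ) := by
    simpa only [Finset.mul_sum, Real.exp_sum] using
      Integrable.fintype_prod (μ := fun _ : ι => μ) fun _ => hint
  calc _ ≤ Real.exp (-l * t) *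
        mgf (∑ i, fun x : ι → Ω => Y (x i)) (Measure.pi fun _ => μ) l := by
        rw [show (∑ i, fun x : ι → Ω => Y (x i)) = fun x => ∑ i, Y (x i) by ext; simp]
        exact measure_ge_le_exp_mul_mgf t hl hint_sum
    _ = Real.exp (-l * t) * mgf Y μ l ^ Fintype.card ι := by
        rw [hindep.mgf_sum₀ hcoord, Finset.prod_congr rfl fun i _ => hmgf i, Finset.prod_const,
          Finset.card_univ]
    _ ≤ Real.exp (-l * t) * Real.exp (l ^ 2 * v) ^ Fintype.card ι := by
        gcongr
        · exact mgf_nonneg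
        · exact mgf_le_exp_of_integral_sq_le hY hb hmean hvar hl hlb
    _ = _ := by rw [← Real.exp_nat_mul, ← Real.exp_add]; ring_nf

theorem measureReal_pi_card_successes_le {A : Set Ω} (hA : MeasurableSet A) {u : ℝ}
    (hu : 0 ≤ u) :
    (Measure.pi fun _ : ι => μ).real
        {y | ((successes A y).card : ℝ) ≤ Fintype.card ι * μ.real A - u} ≤
      Real.exp (-(2 * u ^ 2 / Fintype.card ι)) := by
  let Y : Ω → ℝ := A.indicator 1
  let σ : NNReal := (‖(1 : ℝ) - 0‖₊ / 2) ^ 2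
  have hYm : Measurable Y := measurable_one.indicator hA
  have hmean : μ[Y] = μ.real A := integral_indicator_one hA
  have hsub : HasSubgaussianMGF (fun x => μ.real A - Y x) σ μ := by
    have h01 (x : Ω) : Y x ∈ Set.Icc 0 1 :=
      ⟨Set.indicator_nonneg (fun _ _ => zero_le_one) x,
        Set.indicator_le_self' (fun _ _ => zero_le_one) x⟩
    convert (hasSubgaussianMGF_of_mem_Icc hYm.aemeasurable (ae_of_all μ h01)).neg using 2
    simp [hmean]
  have hindep : iIndepFun (fun (i : ι) y => μ.real A - Y (y i)) (Measure.pi fun _ : ι => μ) :=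
    iIndepFun_pi (X := fun _ x => μ.real A - Y x) fun _ => (hYm.const_sub _).aemeasurable
  have hsum (y : ι → Ω) : ∑ i, (μ.real A - Y (y i)) =
      Fintype.card ι * μ.real A - (successes A y).card := by
    classical
    simp [Y, successes, Finset.sum_sub_distrib, Set.indicator_apply, Finset.sum_boole]
  have hcoord (i : ι) : HasSubgaussianMGF (fun y : ι → Ω => μ.real A - Y (y i))
      σ (Measure.pi fun _ => μ) := by
    refine HasSubgaussianMGF.of_map (X := fun x => μ.real A - Y x)
      (measurable_pi_apply i).aemeasurable ?_
    rwa [(measurePreserving_eval (fun _ : ι => μ) i).map_eq]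
  have := HasSubgaussianMGF.measure_sum_ge_le_of_iIndepFun hindep (s := Finset.univ)
    (fun i _ => hcoord i) hu
  simp only [hsum, le_sub_comm (a := u)] at this
  refine this.trans_eq ?_
  congr 1
  simp only [σ]
  norm_num
  ring

end Concentration

/-! ### Independence of the accepted points -/

section Selection

variable {Ω X ι : Type*} [Fintype ι] {A : Set Ω}

/-- The images under `p` of the draws that fall into `A`, in the order in which they were drawn,
when there are `k` of them. -/
def selected [LinearOrder ι] {k : ℕ} (p : Ω → X) (A : Set Ω) (y : ι → Ω)
    (h : (successes A y).card = k) : Fin k → X :=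
  fun i => p (y ((successes A y).orderEmbOfFin h i))

theorem setOf_selected_mem [LinearOrder ι] {k : ℕ} (p : Ω → X) (A : Set Ω)
    (B : Set (Fin k → X)) :
    {y : ι → Ω | ∃ h : (successes A y).card = k, selected p A y h ∈ B} =
      ⋃ S : {S : Finset ι // S.card = k}, {y | successes A y = S.1} ∩
        (fun y i => p (y (S.1.orderEmbOfFin S.2 i))) ⁻¹' B := by
  ext y
  simp only [Set.mem_ofPred_eq, Set.mem_iUnion, Set.mem_inter_iff, Set.mem_preimage]
  constructor
  · rintro ⟨h, hB⟩
    exact ⟨⟨_, h⟩, rfl, hB⟩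
  · rintro ⟨⟨S, hS⟩, rfl, hB⟩
    exact ⟨hS, hB⟩

variable [MeasurableSpace Ω] [MeasurableSpace X]

theorem measurableSet_successes_eq (hA : MeasurableSet A) (S : Finset ι) :
    MeasurableSet {y : ι → Ω | successes A y = S} := by
  simp only [Finset.ext_iff, mem_successes, Set.ofPred_forall]
  exact MeasurableSet.iInter fun i => (measurable_pi_apply i hA).iff (.const _)

theorem measurableSet_selected_mem [LinearOrder ι] {k : ℕ} {p : Ω → X} (hp : Measurable p)
    (hA : MeasurableSet A) {B : Set (Fin k → X)} (hB : MeasurableSet B) :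
    MeasurableSet {y : ι → Ω | ∃ h : (successes A y).card = k, selected p A y h ∈ B} := by
  rw [setOf_selected_mem]
  exact MeasurableSet.iUnion fun S => (measurableSet_successes_eq hA _).inter
    ((by fun_prop : Measurable fun (y : ι → Ω) i => p (y (S.1.orderEmbOfFin S.2 i))) hB)

variable {μ : Measure Ω} [IsFiniteMeasure μ] {ν : Measure X} {p : Ω → X} {α : ENNReal}

theorem pi_successes_eq_inter_preimage_pi (hp : Measurable p)
    (hα : (μ.restrict A).map p = α • ν) (S : Finset ι) {D : S → Set X}
    (hD : ∀ i, MeasurableSet (D i)) :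
    (Measure.pi fun _ : ι => μ) ({y | successes A y = S} ∩
        (fun y (i : S) => p (y i)) ⁻¹' Set.univ.pi D) =
      (∏ i, α * ν (D i)) * μ Aᶜ ^ (Fintype.card ι - S.card) := by
  classical
  let F : ι → Set Ω := fun i => if h : i ∈ S then A ∩ p ⁻¹' D ⟨i, h⟩ else Aᶜ
  have hF : {y | successes A y = S} ∩ (fun (y : ι → Ω) (i : S) => p (y i)) ⁻¹' Set.univ.pi D =
      Set.univ.pi F := by
    ext y
    simp only [Finset.ext_iff, mem_successes, Set.mem_inter_iff, Set.mem_ofPred_eq,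
      Set.mem_preimage, Set.mem_univ_pi, Subtype.forall, ← forall_and]
    refine forall_congr' fun i => ?_
    by_cases hi : i ∈ S <;> simp [F, hi]
  have hpD (i : S) : μ (A ∩ p ⁻¹' D i) = α * ν (D i) := by
    rw [Set.inter_comm, ← Measure.restrict_apply (hp (hD i)), ← Measure.map_apply hp (hD i), hα,
      Measure.smul_apply, smul_eq_mul]
  rw [hF, Measure.pi_pi]
  simp only [F, apply_dite μ, Fintype.prod_dite, hpD, Finset.prod_const, Finset.card_univ,
    Fintype.card_subtype_compl, Fintype.card_coe]
  congr!

variable [IsProbabilityMeasure ν]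

theorem map_restrict_successes_eq (hp : Measurable p)
    (hα : (μ.restrict A).map p = α • ν) (S : Finset ι) :
    ((Measure.pi fun _ : ι => μ).restrict {y | successes A y = S}).map (fun y (i : S) => p (y i)) =
      (Measure.pi fun _ : ι => μ) {y | successes A y = S} • Measure.pi fun _ : S => ν := by
  have hsel : Measurable fun (y : ι → Ω) (i : S) => p (y i) := by fun_prop
  have hmass : (Measure.pi fun _ : ι => μ) {y | successes A y = S} =
      (∏ _i : S, α) * μ Aᶜ ^ (Fintype.card ι - S.card) := by
    simpa using pi_successes_eq_inter_preimage_pi hp hα S (D := fun _ => Set.univ)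
      fun _ => MeasurableSet.univ
  refine ext_of_generate_finite _ generateFrom_pi.symm isPiSystem_pi ?_ ?_
  · rintro _ ⟨D, hD, rfl⟩
    have hDm (i : S) : MeasurableSet (D i) := hD i (Set.mem_univ i)
    have hpiD : MeasurableSet (Set.univ.pi D) := MeasurableSet.univ_pi hDm
    rw [Measure.map_apply hsel hpiD, Measure.restrict_apply (hsel hpiD), Set.inter_comm,
      pi_successes_eq_inter_preimage_pi hp hα S hDm, Measure.smul_apply, Measure.pi_pi, hmass,
      smul_eq_mul, Finset.prod_mul_distrib]
    ring
  · rw [Measure.map_apply hsel MeasurableSet.univ]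
    simp

theorem pi_successes_eq_inter [LinearOrder ι] {k : ℕ} (hp : Measurable p)
    (hα : (μ.restrict A).map p = α • ν) {S : Finset ι} (hS : S.card = k) {B : Set (Fin k → X)}
    (hB : MeasurableSet B) :
    (Measure.pi fun _ : ι => μ) ({y | successes A y = S} ∩
        (fun y i => p (y (S.orderEmbOfFin hS i))) ⁻¹' B) =
      (Measure.pi fun _ : ι => μ) {y | successes A y = S} *
        (Measure.pi fun _ : Fin k => ν) B := by
  let reindex := MeasurableEquiv.arrowCongr' (S.orderIsoOfFin hS).symm.toEquiv
    (MeasurableEquiv.refl X)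
  have hreindex (y : ι → Ω) : reindex (fun i : S => p (y i)) =
      fun i => p (y (S.orderEmbOfFin hS i)) := rfl
  have hpres : MeasurePreserving reindex (Measure.pi fun _ : S => ν)
      (Measure.pi fun _ : Fin k => ν) :=
    measurePreserving_arrowCongr' _ _ _ _ fun _ => MeasurePreserving.id ν
  have hsel : Measurable fun (y : ι → Ω) (i : S) => p (y i) := by fun_prop
  have hrB : MeasurableSet (reindex ⁻¹' B) := reindex.measurable hB
  calc _ = ((Measure.pi fun _ : ι => μ).restrict {y | successes A y = S}).map
        (fun y (i : S) => p (y i)) (reindex ⁻¹' B) := by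
        rw [Measure.map_apply hsel hrB, Measure.restrict_apply (hsel hrB), Set.inter_comm]
        simp only [Set.preimage_preimage, hreindex]
    _ = (Measure.pi fun _ : ι => μ) {y | successes A y = S} *
        (Measure.pi fun _ : S => ν) (reindex ⁻¹' B) := by
        rw [map_restrict_successes_eq hp hα, Measure.smul_apply, smul_eq_mul]
    _ = _ := by
        rw [hpres.measure_preimage hB.nullMeasurableSet]

theorem pi_selected_mem [LinearOrder ι] {k : ℕ} (hp : Measurable p) (hA : MeasurableSet A)
    (hα : (μ.restrict A).map p = α • ν) {B : Set (Fin k → X)} (hB : MeasurableSet B) :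
    (Measure.pi fun _ : ι => μ) {y | ∃ h : (successes A y).card = k, selected p A y h ∈ B} =
      (Measure.pi fun _ : ι => μ) {y | (successes A y).card = k} *
        (Measure.pi fun _ : Fin k => ν) B := by
  have hsum {B : Set (Fin k → X)} (hB : MeasurableSet B) : (Measure.pi fun _ : ι => μ)
      {y | ∃ h : (successes A y).card = k, selected p A y h ∈ B} =
      (∑ S : {S : Finset ι // S.card = k},
        (Measure.pi fun _ : ι => μ) {y | successes A y = S.1}) *
        (Measure.pi fun _ : Fin k => ν) B := by
    rw [setOf_selected_mem, measure_iUnion, tsum_fintype, Finset.sum_mul]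
    · exact Finset.sum_congr rfl fun S _ => pi_successes_eq_inter hp hα S.2 hB
    · exact fun S S' hne => Set.disjoint_left.2 fun y hy hy' =>
        hne (Subtype.ext (hy.1.symm.trans hy'.1))
    · exact fun S => (measurableSet_successes_eq hA _).inter
        ((by fun_prop : Measurable fun (y : ι → Ω) i => p (y (S.1.orderEmbOfFin S.2 i))) hB)
  rw [hsum hB, show {y : ι → Ω | (successes A y).card = k} =
    {y | ∃ h : (successes A y).card = k, selected p A y h ∈ Set.univ} by simp,
    hsum MeasurableSet.univ, measure_univ, mul_one]

end Selection

/-! ### Rejection sampling -/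

section RejectionSampling

variable {d : ℕ} {f q : EuclideanSpace ℝ (Fin d) → ℝ} {W : ℝ}

/-- The proposal `q` with rejection constant `W` is admissible for the target `f`: the envelope
`W q` dominates `f` everywhere. The proposal need not be normalised. -/
structure IsProposal (f q : EuclideanSpace ℝ (Fin d) → ℝ) (W : ℝ) : Prop where
  measurable : Measurable q
  integrable : Integrable q
  nonneg : ∀ x, 0 ≤ q x
  pos : 0 < W
  le_mul : ∀ x, f x ≤ W * q x

theorem IsDensity.integrable (hf : IsDensity f) : Integrable f :=
  integrable_of_integral_eq_one hf.integral_eq_one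

theorem densityMeasure_univ (hq : Integrable q) (hq₀ : ∀ x, 0 ≤ q x) :
    densityMeasure q Set.univ = ENNReal.ofReal (∫ x, q x) := by
  rw [densityMeasure, withDensity_apply _ MeasurableSet.univ, Measure.restrict_univ,
    ofReal_integral_eq_lintegral_ofReal hq (ae_of_all _ hq₀)]

theorem IsDensity.isProbabilityMeasure (hf : IsDensity f) :
    IsProbabilityMeasure (densityMeasure f) :=
  ⟨by rw [densityMeasure_univ hf.integrable hf.nonneg, hf.integral_eq_one, ENNReal.ofReal_one]⟩

theorem normalizedLaw_univ_le_one (q : EuclideanSpace ℝ (Fin d) → ℝ) :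
    normalizedLaw q Set.univ ≤ 1 := by
  rw [normalizedLaw, Measure.smul_apply, smul_eq_mul]
  exact ENNReal.inv_mul_le_one _

instance isFiniteMeasure_normalizedLaw (q : EuclideanSpace ℝ (Fin d) → ℝ) :
    IsFiniteMeasure (normalizedLaw q) :=
  ⟨(normalizedLaw_univ_le_one q).trans_lt ENNReal.one_lt_top⟩

instance isProbabilityMeasure_uniform :
    IsProbabilityMeasure (volume.restrict (Set.Icc (0 : ℝ) 1)) :=
  ⟨by simp⟩

theorem IsDensity.one_le_mul_integral (hf : IsDensity f) (hq : IsProposal f q W) :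
    1 ≤ W * ∫ x, q x := by
  rw [← hf.integral_eq_one, ← integral_const_mul]
  exact integral_mono hf.integrable (hq.integrable.const_mul W) hq.le_mul

theorem IsProposal.integral_pos (hq : IsProposal f q W) (hf : IsDensity f) : 0 < ∫ x, q x :=
  pos_of_mul_pos_right (one_pos.trans_le (hf.one_le_mul_integral hq)) hq.pos.le

theorem IsProposal.isProbabilityMeasure (hq : IsProposal f q W) (hf : IsDensity f) :
    IsProbabilityMeasure (normalizedLaw q) := by
  refine ⟨?_⟩
  rw [normalizedLaw, Measure.smul_apply, smul_eq_mul, densityMeasure_univ hq.integrable hq.nonneg]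
  exact ENNReal.inv_mul_cancel (ENNReal.ofReal_pos.2 (hq.integral_pos hf)).ne'
    ENNReal.ofReal_ne_top

/-- The pairs (proposed point, uniform variable) that rejection sampling towards `f` with envelope
`e` accepts. -/
def acceptSet (f e : EuclideanSpace ℝ (Fin d) → ℝ) : Set (EuclideanSpace ℝ (Fin d) × ℝ) :=
  {z | z.2 * e z.1 ≤ f z.1}

theorem measurableSet_acceptSet {e : EuclideanSpace ℝ (Fin d) → ℝ} (hf : Measurable f)
    (he : Measurable e) : MeasurableSet (acceptSet f e) :=
  measurableSet_le (measurable_snd.mul (he.comp measurable_fst)) (hf.comp measurable_fst)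

theorem volume_restrict_Icc_setOf_mul_le {e t : ℝ} (he : 0 < e) (hte : t ≤ e) :
    volume.restrict (Set.Icc (0 : ℝ) 1) {u | u * e ≤ t} = ENNReal.ofReal (t / e) := by
  have hset : {u : ℝ | u * e ≤ t} = Set.Iic (t / e) := Set.ext fun _ => (le_div_iff₀ he).symm
  rw [hset, Measure.restrict_apply measurableSet_Iic, Set.inter_comm, ← Set.Ici_inter_Iic,
    Set.inter_assoc, Set.Iic_inter_Iic, inf_eq_right.2 ((div_le_one he).2 hte), Set.Ici_inter_Iic,
    Real.volume_Icc, sub_zero]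

theorem ofReal_mul_volume_setOf_mul_le {y t : ℝ} (hy : 0 ≤ y) (hW : 0 < W) (ht : t ≤ W * y) :
    ENNReal.ofReal y * volume.restrict (Set.Icc (0 : ℝ) 1) {u | u * (W * y) ≤ t} =
      (ENNReal.ofReal W)⁻¹ * ENNReal.ofReal t := by
  rcases hy.eq_or_lt with rfl | hy
  · simp [ENNReal.ofReal_of_nonpos (ht.trans_eq (mul_zero W))]
  · rw [volume_restrict_Icc_setOf_mul_le (mul_pos hW hy) ht, ← ENNReal.ofReal_mul hy.le,
      ← ENNReal.ofReal_inv_of_pos hW, ← ENNReal.ofReal_mul (inv_nonneg.2 hW.le)]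
    congr 1
    field_simp

theorem map_fst_restrict_acceptSet (hf : Measurable f) (hq : IsProposal f q W) :
    (((normalizedLaw q).prod (volume.restrict (Set.Icc (0 : ℝ) 1))).restrict
        (acceptSet f fun x => W * q x)).map Prod.fst =
      ((densityMeasure q Set.univ)⁻¹ * (ENNReal.ofReal W)⁻¹) • densityMeasure f := by
  ext B hB
  have hA : MeasurableSet (Prod.fst ⁻¹' B ∩ acceptSet f fun x => W * q x) :=
    (measurable_fst hB).inter (measurableSet_acceptSet hf (hq.measurable.const_mul W))
  have hfB : densityMeasure f B = ∫⁻ x in B, ENNReal.ofReal (f x) := withDensity_apply _ hB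
  have hfiber (x : EuclideanSpace ℝ (Fin d)) :
      ENNReal.ofReal (q x) * volume.restrict (Set.Icc (0 : ℝ) 1)
          (Prod.mk x ⁻¹' (Prod.fst ⁻¹' B ∩ acceptSet f fun x => W * q x)) =
        (ENNReal.ofReal W)⁻¹ * B.indicator (fun x => ENNReal.ofReal (f x)) x := by
    by_cases hx : x ∈ B
    · rw [Set.indicator_of_mem hx, ← ofReal_mul_volume_setOf_mul_le (hq.nonneg x) hq.pos
        (hq.le_mul x)]
      congr 2
      ext u
      simp [acceptSet, hx]
    · have hempty : Prod.mk x ⁻¹' (Prod.fst ⁻¹' B ∩ acceptSet f fun x => W * q x) = ∅ := by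
        ext u
        simp [hx]
      simp [hempty, hx]
  calc _ = (densityMeasure q Set.univ)⁻¹ * ∫⁻ x, ENNReal.ofReal (q x) *
          volume.restrict (Set.Icc (0 : ℝ) 1)
            (Prod.mk x ⁻¹' (Prod.fst ⁻¹' B ∩ acceptSet f fun x => W * q x)) := by
        rw [Measure.map_apply measurable_fst hB, Measure.restrict_apply (measurable_fst hB),
          Measure.prod_apply hA, normalizedLaw, lintegral_smul_measure, smul_eq_mul,
          densityMeasure, lintegral_withDensity_eq_lintegral_mul _ hq.measurable.ennreal_ofReal
            (measurable_measure_prodMk_left hA)]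
        rfl
    _ = (densityMeasure q Set.univ)⁻¹ * ((ENNReal.ofReal W)⁻¹ * densityMeasure f B) := by
        simp_rw [hfiber]
        rw [lintegral_const_mul _ (hf.ennreal_ofReal.indicator hB), lintegral_indicator hB, hfB]
    _ = _ := by rw [Measure.smul_apply, smul_eq_mul, mul_assoc]

theorem outputIID_drawLaw {m : ℕ} (hf : IsDensity f) (hq : IsProposal f q W) :
    OutputIID (drawLaw m q) f fun x => W * q x := by
  intro k B hB
  have := hf.isProbabilityMeasure
  exact pi_selected_mem measurable_fst
    (measurableSet_acceptSet hf.measurable (hq.measurable.const_mul W))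
    (map_fst_restrict_acceptSet hf.measurable hq) hB

theorem real_acceptSet (hf : IsDensity f) (hq : IsProposal f q W) :
    ((normalizedLaw q).prod (volume.restrict (Set.Icc (0 : ℝ) 1))).real
      (acceptSet f fun x => W * q x) = (W * ∫ x, q x)⁻¹ := by
  have := hf.isProbabilityMeasure
  have h := congr_arg (· Set.univ) (map_fst_restrict_acceptSet hf.measurable hq)
  simp only [Measure.map_apply measurable_fst MeasurableSet.univ, Set.preimage_univ,
    Measure.restrict_apply_univ, Measure.smul_apply, measure_univ, smul_eq_mul, mul_one,
    densityMeasure_univ hq.integrable hq.nonneg] at h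
  rw [Measure.real, h, ENNReal.toReal_mul, ENNReal.toReal_inv, ENNReal.toReal_inv,
    ENNReal.toReal_ofReal (hq.integral_pos hf).le, ENNReal.toReal_ofReal hq.pos.le, mul_inv_rev]

theorem drawLaw_real_card_accepted_le {m : ℕ} (hf : IsDensity f) (hq : IsProposal f q W) {u : ℝ}
    (hu : 0 ≤ u) :
    (drawLaw m q).real {y | ((accepted f (fun x => W * q x) y).card : ℝ) ≤
        m * (W * ∫ x, q x)⁻¹ - u} ≤ Real.exp (-(2 * u ^ 2 / m)) := by
  have := hq.isProbabilityMeasure hf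
  have h := measureReal_pi_card_successes_le (ι := Fin m)
    (measurableSet_acceptSet hf.measurable (hq.measurable.const_mul W))
    (μ := (normalizedLaw q).prod (volume.restrict (Set.Icc (0 : ℝ) 1))) hu
  rwa [real_acceptSet hf hq, Fintype.card_fin] at h

end RejectionSampling

/-! ### The law of a run -/

section RunLaw

theorem mul_le_compProd {Ω Ω' : Type*} [MeasurableSpace Ω] [MeasurableSpace Ω'] {μ : Measure Ω}
    [SFinite μ] {κ : Kernel Ω Ω'} [IsSFiniteKernel κ] {G : Set Ω} (hG : MeasurableSet G)
    {S : Set (Ω × Ω')} {b : ENNReal} (h : ∀ w ∈ G, b ≤ κ w (Prod.mk w ⁻¹' S)) :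
    b * μ G ≤ (μ ⊗ₘ κ) S :=
  calc b * μ G = ∫⁻ _ in G, b ∂μ := (setLIntegral_const _ _).symm
    _ ≤ ∫⁻ w in G, κ w (Prod.mk w ⁻¹' S) ∂μ := setLIntegral_mono' hG h
    _ ≤ ∫⁻ w, κ w (Prod.mk w ⁻¹' S) ∂μ := setLIntegral_le_lintegral _ _
    _ ≤ (μ ⊗ₘ κ) S := Kernel.le_compProd_apply _ _ () S

theorem measurable_prod_const {Ω α β : Type*} [MeasurableSpace Ω] [MeasurableSpace α]
    [MeasurableSpace β] {μ : Ω → Measure α} [∀ w, IsFiniteMeasure (μ w)] (hμ : Measurable μ)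
    (ν : Measure β) [IsFiniteMeasure ν] : Measurable fun w => (μ w).prod ν := by
  have hrect {A : Set α} (hA : MeasurableSet A) (B : Set β) :
      Measurable fun w => μ w A * ν B :=
    ((Measure.measurable_coe hA).comp hμ).mul_const _
  refine Measurable.measure_of_isPiSystem generateFrom_prod.symm isPiSystem_prod ?_ ?_
  · rintro _ ⟨A, hA, B, -, rfl⟩
    simpa only [Measure.prod_prod] using hrect hA B
  · simpa only [← Set.univ_prod_univ, Measure.prod_prod] using hrect MeasurableSet.univ Set.univ

theorem measurable_pi_const {Ω α ι : Type*} [MeasurableSpace Ω] [MeasurableSpace α] [Fintype ι]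
    {μ : Ω → Measure α} [∀ w, IsFiniteMeasure (μ w)] (hμ : Measurable μ) :
    Measurable fun w => Measure.pi fun _ : ι => μ w := by
  have hrect {A : ι → Set α} (hA : ∀ i, MeasurableSet (A i)) :
      Measurable fun w => ∏ i, μ w (A i) :=
    Finset.measurable_prod _ fun i _ => (Measure.measurable_coe (hA i)).comp hμ
  refine Measurable.measure_of_isPiSystem generateFrom_pi.symm isPiSystem_pi ?_ ?_
  · rintro _ ⟨A, hA, rfl⟩
    simpa only [Measure.pi_pi] using hrect fun i => hA i (Set.mem_univ i)
  · simpa only [← Set.pi_univ Set.univ, Measure.pi_pi] using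
      hrect (A := fun _ => Set.univ) fun _ => MeasurableSet.univ

variable {d : ℕ}

theorem measurable_normalizedLaw {Ω : Type*} [MeasurableSpace Ω]
    {q : Ω → EuclideanSpace ℝ (Fin d) → ℝ}
    (hq : Measurable fun z : Ω × EuclideanSpace ℝ (Fin d) => q z.1 z.2) :
    Measurable fun w => normalizedLaw (q w) := by
  have hB {B : Set (EuclideanSpace ℝ (Fin d))} (hB : MeasurableSet B) :
      Measurable fun w => densityMeasure (q w) B := by
    simpa only [densityMeasure, withDensity_apply _ hB] using
      hq.ennreal_ofReal.lintegral_prod_right' (ν := volume.restrict B)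
  refine Measure.measurable_of_measurable_coe _ fun B hB' => ?_
  simp only [normalizedLaw, Measure.smul_apply, smul_eq_mul]
  exact (hB MeasurableSet.univ).inv.mul (hB hB')

theorem measurable_drawLaw {Ω : Type*} [MeasurableSpace Ω] (m : ℕ)
    {q : Ω → EuclideanSpace ℝ (Fin d) → ℝ}
    (hq : Measurable fun z : Ω × EuclideanSpace ℝ (Fin d) => q z.1 z.2) :
    Measurable fun w => drawLaw m (q w) :=
  measurable_pi_const (measurable_prod_const (measurable_normalizedLaw hq) _)

theorem drawLaw_univ_le_one (m : ℕ) (q : EuclideanSpace ℝ (Fin d) → ℝ) :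
    drawLaw m q Set.univ ≤ 1 := by
  rw [drawLaw, Measure.pi_univ]
  refine Finset.prod_le_one' fun i _ => ?_
  rw [← Set.univ_prod_univ, Measure.prod_prod,
    measure_univ (μ := volume.restrict (Set.Icc (0 : ℝ) 1)), mul_one]
  exact normalizedLaw_univ_le_one q

theorem measurable_card_accepted {m : ℕ} {f e : EuclideanSpace ℝ (Fin d) → ℝ}
    (hf : Measurable f) (he : Measurable e) :
    Measurable fun w : Fin m → EuclideanSpace ℝ (Fin d) × ℝ => (accepted f e w).card := by
  classical
  have hi (i : Fin m) : MeasurableSet {w : Fin m → EuclideanSpace ℝ (Fin d) × ℝ |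
      (w i).2 * e (w i).1 ≤ f (w i).1} :=
    (measurableSet_acceptSet hf he).preimage (measurable_pi_apply i)
  simp only [accepted, Finset.card_filter]
  exact Finset.measurable_sum _ fun i _ => Measurable.ite (hi i) measurable_const measurable_const

theorem KernelAssumption.measurable {K₀ : ℝ → ℝ} {C C' C'' ε : ℝ}
    (hK : KernelAssumption K₀ C C' C'' ε) (hε : 0 < ε) : Measurable K₀ := by
  refine (continuous_iff_continuousAt.2 fun x => ?_).measurable
  have hmod : Tendsto (fun y => C'' * |x - y| ^ ε) (𝓝 x) (𝓝 0) := by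
    have : Continuous fun y : ℝ => C'' * |x - y| ^ ε :=
      continuous_const.mul ((continuous_const.sub continuous_id).abs.rpow_const
        fun _ => Or.inr hε.le)
    simpa [Real.zero_rpow hε.ne'] using this.tendsto x
  exact tendsto_iff_dist_tendsto_zero.2
    (squeeze_zero (fun _ => dist_nonneg) (fun y => hK.holder x y) hmod)

variable {K₀ : ℝ → ℝ} {f g : EuclideanSpace ℝ (Fin d) → ℝ}

theorem measurable_fTilde (hK : Measurable K₀) (hf : Measurable f) (hg : Measurable g)
    (s M δ : ℝ) (T : ℕ) :
    Measurable fun z : (Fin T → EuclideanSpace ℝ (Fin d) × ℝ) × EuclideanSpace ℝ (Fin d) =>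
      fTilde K₀ f g s M δ z.1 z.2 := by
  classical
  have he : Measurable fun z => M * g z := hg.const_mul M
  have hcard : Measurable fun z : (Fin T → EuclideanSpace ℝ (Fin d) × ℝ) ×
      EuclideanSpace ℝ (Fin d) => (accepted f (fun z => M * g z) z.1).card :=
    (measurable_card_accepted hf he).comp measurable_fst
  have hcast : Measurable (Nat.cast : ℕ → ℝ) := measurable_of_countable _
  have hN := hcast.comp hcard
  have hh := (measurable_of_countable (bandwidth d s δ)).comp hcard
  refine Measurable.ite (measurableSet_le measurable_snd.norm (Real.measurable_log.comp hN))
    (((hN.mul (hh.pow_const d)).const_div 1).mul ?_) measurable_const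
  simp only [accepted, Finset.sum_filter]
  refine Finset.measurable_sum _ fun k _ => ?_
  have hk : Measurable fun z : (Fin T → EuclideanSpace ℝ (Fin d) × ℝ) ×
      EuclideanSpace ℝ (Fin d) => z.1 k := (measurable_pi_apply k).comp measurable_fst
  refine Measurable.ite (hk (measurableSet_acceptSet hf he)) ?_ measurable_const
  refine Finset.measurable_prod _ fun i _ => hK.comp (Measurable.div (Measurable.sub ?_ ?_) hh)
  · exact (EuclideanSpace.proj (𝕜 := ℝ) i).continuous.measurable.comp hk.fst
  · exact (EuclideanSpace.proj (𝕜 := ℝ) i).continuous.measurable.comp measurable_snd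

theorem measurable_pliable (hK : Measurable K₀) (hf : Measurable f) (hg : Measurable g)
    (s M δ H : ℝ) (n T : ℕ) :
    Measurable fun z : (Fin T → EuclideanSpace ℝ (Fin d) × ℝ) × EuclideanSpace ℝ (Fin d) =>
      pliable K₀ f g s M δ H n z.1 z.2 :=
  (((measurable_fTilde hK hf hg s M δ T).add (Measurable.const_mul (Measurable.ite
    (measurable_snd Metric.isClosed_closedBall.measurableSet) measurable_const measurable_const)
    _)).add (Measurable.ite (measurableSet_le measurable_const measurable_snd.norm)
      ((hg.comp measurable_snd).const_mul M) measurable_const)).const_mul _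

theorem mul_le_runLaw (hK : Measurable K₀) (hf : Measurable f) (hg : Measurable g)
    {s M δ H : ℝ} {n : ℕ} {G : Set (Fin (initCalls d s n) → EuclideanSpace ℝ (Fin d) × ℝ)}
    (hG : MeasurableSet G) {t : ℝ} {b : ENNReal}
    (hb : ∀ w ∈ G, b ≤ stageTwoLaw K₀ f g s M δ H n w
      {y | t ≤ (accepted f (envelope K₀ f g s M δ H n w) y).card}) :
    b * stageOneLaw g s n G ≤ runLaw K₀ f g s M δ H n
      {ω | ω.1 ∈ G ∧ t ≤ (numOutput K₀ f g s M δ H n ω : ℝ)} := by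
  let κ : Kernel (Fin (initCalls d s n) → EuclideanSpace ℝ (Fin d) × ℝ)
      (Fin (n - initCalls d s n) → EuclideanSpace ℝ (Fin d) × ℝ) :=
    ⟨stageTwoLaw K₀ f g s M δ H n, measurable_drawLaw _ (measurable_pliable hK hf hg _ _ _ _ _ _)⟩
  have : IsFiniteKernel κ := ⟨1, ENNReal.one_lt_top, fun w => drawLaw_univ_le_one _ _⟩
  have : SFinite (stageOneLaw g s n) := by unfold stageOneLaw drawLaw; infer_instance
  have hrun : runLaw K₀ f g s M δ H n = stageOneLaw g s n ⊗ₘ κ := by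
    rw [Measure.compProd_eq_comp_prod, runLaw]
    congr 1
    funext w
    rw [Kernel.prod_apply, Kernel.id_apply, Measure.dirac_prod]
    rfl
  rw [hrun]
  refine mul_le_compProd hG fun w hw => (hb w hw).trans (measure_mono fun y hy => ?_)
  exact ⟨hw, hy⟩

end RunLaw

/-! ### Kernel smoothing -/

section Kernel

variable {d : ℕ} {K₀ : ℝ → ℝ} {C C' C'' ε : ℝ}

/-- The product kernel on `ℝ^d`. -/
def prodKernel (K₀ : ℝ → ℝ) (v : EuclideanSpace ℝ (Fin d)) : ℝ := ∏ i, K₀ (v i)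

/-- The product kernel with bandwidth `h` centred at `y`, normalised so as to be a density. -/
def scaledKernel (K₀ : ℝ → ℝ) (h : ℝ) (y x : EuclideanSpace ℝ (Fin d)) : ℝ :=
  1 / h ^ d * ∏ i, K₀ ((x i - y i) / h)

theorem integrable_prod_coord {φ : Fin d → ℝ → ℝ} (hφ : ∀ i, Integrable (φ i)) :
    Integrable fun v : EuclideanSpace ℝ (Fin d) => ∏ i, φ i (v i) :=
  ((EuclideanSpace.volume_preserving_symm_measurableEquiv_toLp (Fin d)).integrable_comp_emb
    (MeasurableEquiv.measurableEmbedding _)).2 (Integrable.fintype_prod hφ)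

theorem integral_prod_coord (φ : Fin d → ℝ → ℝ) :
    ∫ v : EuclideanSpace ℝ (Fin d), ∏ i, φ i (v i) = ∏ i, ∫ x, φ i x := by
  rw [← integral_fintype_prod_volume_eq_prod]
  exact (EuclideanSpace.volume_preserving_symm_measurableEquiv_toLp (Fin d)).integral_comp'
    fun v : Fin d → ℝ => ∏ i, φ i (v i)

theorem coord_mul_prodKernel (ψ : ℝ → ℝ) (j : Fin d) (v : EuclideanSpace ℝ (Fin d)) :
    ψ (v j) * prodKernel K₀ v =
      ∏ i, (if i = j then fun x => ψ x * K₀ x else K₀) (v i) := by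
  rw [prodKernel, ← Finset.mul_prod_erase _ _ (Finset.mem_univ j),
    ← Finset.mul_prod_erase _ _ (Finset.mem_univ j), if_pos rfl, mul_assoc]
  congr 2
  exact Finset.prod_congr rfl fun i hi => by rw [if_neg (Finset.ne_of_mem_erase hi)]

theorem inner_mul_prodKernel (a v : EuclideanSpace ℝ (Fin d)) :
    inner ℝ a v * prodKernel K₀ v = ∑ j, a j * (v j * prodKernel K₀ v) := by
  simp only [PiLp.inner_apply, Real.inner_apply, Finset.sum_mul, mul_assoc]

theorem norm_sq_mul_prodKernel (v : EuclideanSpace ℝ (Fin d)) :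
    ‖v‖ ^ 2 * prodKernel K₀ v = ∑ j, v j ^ 2 * prodKernel K₀ v := by
  rw [EuclideanSpace.real_norm_sq_eq, Finset.sum_mul]

theorem scaledKernel_eq (h : ℝ) (y x : EuclideanSpace ℝ (Fin d)) :
    scaledKernel K₀ h y x = (h ^ d)⁻¹ * prodKernel K₀ (h⁻¹ • (x - y)) := by
  simp only [scaledKernel, prodKernel, PiLp.smul_apply, PiLp.sub_apply, smul_eq_mul,
    div_eq_inv_mul, mul_one]

theorem measurable_scaledKernel (hK : Measurable K₀) (h : ℝ) (y : EuclideanSpace ℝ (Fin d)) :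
    Measurable (scaledKernel K₀ h y) := by
  refine Measurable.const_mul (Finset.measurable_prod _ fun i _ =>
    hK.comp (Measurable.div_const (Measurable.sub_const ?_ _) _)) _
  exact (EuclideanSpace.proj (𝕜 := ℝ) i).continuous.measurable

theorem integral_mul_scaledKernel (f : EuclideanSpace ℝ (Fin d) → ℝ) {h : ℝ}
    (hh : 0 < h) (y : EuclideanSpace ℝ (Fin d)) :
    ∫ x, f x * scaledKernel K₀ h y x = ∫ v, f (y + h • v) * prodKernel K₀ v := by
  let F : EuclideanSpace ℝ (Fin d) → ℝ := fun u => f (y + u) * prodKernel K₀ (h⁻¹ • u)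
  have hrescaled (v) : f (y + h • v) * prodKernel K₀ v = F (h • v) := by
    simp only [F, smul_smul, inv_mul_cancel₀ hh.ne', one_smul]
  have htranslated (x) : f x * scaledKernel K₀ h y x = (h ^ d)⁻¹ * F (x - y) := by
    simp only [F, scaledKernel_eq, add_sub_cancel]
    ring
  simp_rw [hrescaled, htranslated]
  rw [integral_const_mul, integral_sub_right_eq_self F y, Measure.integral_comp_smul,
    finrank_euclideanSpace_fin, abs_of_pos (by positivity), smul_eq_mul]

theorem abs_prod_sub_prod_le {ι : Type*} (S : Finset ι) {p q : ι → ℝ} {B η : ℝ}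
    (hp : ∀ i, |p i| ≤ B) (hq : ∀ i, |q i| ≤ B) (hη : ∀ i, |p i - q i| ≤ η) :
    |∏ i ∈ S, p i - ∏ i ∈ S, q i| ≤ S.card * B ^ (S.card - 1) * η := by
  classical
  induction S using Finset.induction_on with
  | empty => simp
  | insert j S hj ih =>
    have hB : 0 ≤ B := (abs_nonneg _).trans (hp j)
    have hη0 : 0 ≤ η := (abs_nonneg _).trans (hη j)
    have hprod : |∏ i ∈ S, q i| ≤ B ^ S.card := by
      rw [Finset.abs_prod, ← Finset.prod_const]
      exact Finset.prod_le_prod (fun _ _ => abs_nonneg _) fun i _ => hq i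
    have hpow : B * (S.card * B ^ (S.card - 1)) = S.card * B ^ S.card := by
      rcases S.card with _ | n
      · simp
      · simp only [Nat.add_sub_cancel, pow_succ']
        ring
    rw [Finset.prod_insert hj, Finset.prod_insert hj, Finset.card_insert_of_notMem hj,
      Nat.add_sub_cancel]
    calc |p j * ∏ i ∈ S, p i - q j * ∏ i ∈ S, q i|
        = |p j * (∏ i ∈ S, p i - ∏ i ∈ S, q i) + (p j - q j) * ∏ i ∈ S, q i| := by ring_nf
      _ ≤ |p j| * |∏ i ∈ S, p i - ∏ i ∈ S, q i| + |p j - q j| * |∏ i ∈ S, q i| := by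
        rw [← abs_mul, ← abs_mul]
        exact abs_add_le _ _
      _ ≤ B * (S.card * B ^ (S.card - 1) * η) + η * B ^ S.card := by
        gcongr
        exacts [hp j, hη j]
      _ = ((S.card + 1 : ℕ) : ℝ) * B ^ S.card * η := by
        rw [← mul_assoc B, hpow]
        push_cast
        ring

namespace KernelAssumption

theorem integrable (hK : KernelAssumption K₀ C C' C'' ε) : Integrable K₀ :=
  integrable_of_integral_eq_one hK.integral_eq_one

theorem integrable_mul (hK : KernelAssumption K₀ C C' C'' ε) :
    Integrable fun x => x * K₀ x := by
  refine (hK.integrable.add hK.integrable_sq_mul).mono'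
    (measurable_id.aestronglyMeasurable.mul hK.integrable.aestronglyMeasurable)
    (ae_of_all _ fun x => ?_)
  have hx : |x| ≤ 1 + x ^ 2 := by nlinarith [sq_abs x, sq_nonneg (|x| - 1), abs_nonneg x]
  calc ‖x * K₀ x‖ = |x| * K₀ x := by rw [Real.norm_eq_abs, abs_mul, abs_of_nonneg (hK.nonneg x)]
    _ ≤ (1 + x ^ 2) * K₀ x := mul_le_mul_of_nonneg_right hx (hK.nonneg x)
    _ = K₀ x + x ^ 2 * K₀ x := by ring

theorem integrable_coord_mul (hK : KernelAssumption K₀ C C' C'' ε) {ψ : ℝ → ℝ}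
    (hψ : Integrable fun x => ψ x * K₀ x) (j : Fin d) :
    Integrable fun v : EuclideanSpace ℝ (Fin d) => ψ (v j) * prodKernel K₀ v := by
  simp_rw [coord_mul_prodKernel]
  refine integrable_prod_coord fun i => ?_
  split_ifs
  · exact hψ
  · exact hK.integrable

theorem integral_coord_mul (hK : KernelAssumption K₀ C C' C'' ε) (ψ : ℝ → ℝ) (j : Fin d) :
    ∫ v : EuclideanSpace ℝ (Fin d), ψ (v j) * prodKernel K₀ v = ∫ x, ψ x * K₀ x := by
  simp_rw [coord_mul_prodKernel]
  rw [integral_prod_coord, ← Finset.mul_prod_erase _ _ (Finset.mem_univ j), if_pos rfl,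
    Finset.prod_eq_one, mul_one]
  intro i hi
  rw [if_neg (Finset.ne_of_mem_erase hi), hK.integral_eq_one]

theorem integrable_prodKernel (hK : KernelAssumption K₀ C C' C'' ε) :
    Integrable (prodKernel K₀ : EuclideanSpace ℝ (Fin d) → ℝ) :=
  integrable_prod_coord fun _ => hK.integrable

theorem integral_prodKernel (hK : KernelAssumption K₀ C C' C'' ε) :
    ∫ v : EuclideanSpace ℝ (Fin d), prodKernel K₀ v = 1 := by
  simp only [prodKernel, integral_prod_coord, hK.integral_eq_one, Finset.prod_const_one]

theorem integrable_inner_mul (hK : KernelAssumption K₀ C C' C'' ε)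
    (a : EuclideanSpace ℝ (Fin d)) :
    Integrable fun v : EuclideanSpace ℝ (Fin d) => inner ℝ a v * prodKernel K₀ v := by
  simp_rw [inner_mul_prodKernel]
  exact integrable_finsetSum _ fun j _ =>
    (hK.integrable_coord_mul (ψ := fun x => x) hK.integrable_mul j).const_mul _

theorem integral_inner_mul (hK : KernelAssumption K₀ C C' C'' ε)
    (a : EuclideanSpace ℝ (Fin d)) :
    ∫ v : EuclideanSpace ℝ (Fin d), inner ℝ a v * prodKernel K₀ v = 0 := by
  simp_rw [inner_mul_prodKernel]
  rw [integral_finsetSum _ fun j _ =>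
    (hK.integrable_coord_mul (ψ := fun x => x) hK.integrable_mul j).const_mul _]
  refine Finset.sum_eq_zero fun j _ => ?_
  rw [integral_const_mul, hK.integral_coord_mul (fun x => x), hK.integral_mul_eq_zero, mul_zero]

theorem integrable_norm_sq_mul (hK : KernelAssumption K₀ C C' C'' ε) :
    Integrable fun v : EuclideanSpace ℝ (Fin d) => ‖v‖ ^ 2 * prodKernel K₀ v := by
  simp_rw [norm_sq_mul_prodKernel]
  exact integrable_finsetSum _ fun j _ =>
    hK.integrable_coord_mul (ψ := fun x => x ^ 2) hK.integrable_sq_mul j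

theorem integral_norm_sq_mul_le (hK : KernelAssumption K₀ C C' C'' ε) :
    ∫ v : EuclideanSpace ℝ (Fin d), ‖v‖ ^ 2 * prodKernel K₀ v ≤ d * C' := by
  simp_rw [norm_sq_mul_prodKernel]
  rw [integral_finsetSum _ fun j _ =>
    hK.integrable_coord_mul (ψ := fun x => x ^ 2) hK.integrable_sq_mul j]
  calc _ ≤ ∑ _j : Fin d, C' := Finset.sum_le_sum fun j _ =>
        (hK.integral_coord_mul (fun x => x ^ 2) j).trans_le hK.integral_sq_mul_le
    _ = d * C' := by simp

theorem prodKernel_nonneg (hK : KernelAssumption K₀ C C' C'' ε)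
    (v : EuclideanSpace ℝ (Fin d)) : 0 ≤ prodKernel K₀ v :=
  Finset.prod_nonneg fun _ _ => hK.nonneg _

variable {h : ℝ}

theorem scaledKernel_nonneg (hK : KernelAssumption K₀ C C' C'' ε)
    (hh : 0 < h) (y x : EuclideanSpace ℝ (Fin d)) : 0 ≤ scaledKernel K₀ h y x :=
  mul_nonneg (by positivity) (Finset.prod_nonneg fun _ _ => hK.nonneg _)

theorem scaledKernel_le (hK : KernelAssumption K₀ C C' C'' ε) (hh : 0 < h)
    (y x : EuclideanSpace ℝ (Fin d)) : scaledKernel K₀ h y x ≤ C ^ d / h ^ d := by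
  have hprod : ∏ i, K₀ ((x i - y i) / h) ≤ C ^ d := by
    simpa using Finset.prod_le_prod (s := Finset.univ)
      (fun i _ => hK.nonneg ((x i - y i) / h)) fun i _ => hK.le_bound ((x i - y i) / h)
  rw [scaledKernel, one_div_mul_eq_div]
  gcongr

theorem abs_scaledKernel_le (hK : KernelAssumption K₀ C C' C'' ε) (hh : 0 < h)
    (y x : EuclideanSpace ℝ (Fin d)) : |scaledKernel K₀ h y x| ≤ C ^ d / h ^ d :=
  (abs_of_nonneg (hK.scaledKernel_nonneg hh y x)).trans_le (hK.scaledKernel_le hh y x)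

theorem integrable_scaledKernel (hK : KernelAssumption K₀ C C' C'' ε)
    (hh : 0 < h) (y : EuclideanSpace ℝ (Fin d)) : Integrable (scaledKernel K₀ h y) := by
  simp_rw [funext (scaledKernel_eq h y)]
  exact ((hK.integrable_prodKernel.comp_smul (inv_ne_zero hh.ne')).comp_sub_right y).const_mul _

theorem integral_scaledKernel (hK : KernelAssumption K₀ C C' C'' ε)
    (hh : 0 < h) (y : EuclideanSpace ℝ (Fin d)) : ∫ x, scaledKernel K₀ h y x = 1 := by
  simpa only [one_mul, hK.integral_prodKernel] using
    integral_mul_scaledKernel (K₀ := K₀) (fun _ => 1) hh y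

theorem abs_scaledKernel_sub_le (hK : KernelAssumption K₀ C C' C'' ε)
    (hC'' : 0 ≤ C'') (hε : 0 ≤ ε) {η : ℝ} (hh : 0 < h)
    {y z : EuclideanSpace ℝ (Fin d)} (hyz : ∀ i, |y i - z i| ≤ η) (x : EuclideanSpace ℝ (Fin d)) :
    |scaledKernel K₀ h y x - scaledKernel K₀ h z x| ≤
      d * C ^ (d - 1) * C'' * (η / h) ^ ε / h ^ d := by
  have habs (t : ℝ) : |K₀ t| ≤ C := (abs_of_nonneg (hK.nonneg t)).trans_le (hK.le_bound t)
  have hfactor (i : Fin d) :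
      |K₀ ((x i - y i) / h) - K₀ ((x i - z i) / h)| ≤ C'' * (η / h) ^ ε := by
    refine (hK.holder _ _).trans ?_
    rw [← sub_div, abs_div, abs_of_pos hh, sub_sub_sub_cancel_left]
    gcongr
    exact hyz i
  have hprod := abs_prod_sub_prod_le Finset.univ (fun _ => habs _) (fun _ => habs _) hfactor
  rw [Finset.card_univ, Fintype.card_fin] at hprod
  rw [scaledKernel, scaledKernel, ← mul_sub, abs_mul, abs_of_pos (by positivity : 0 < 1 / h ^ d),
    one_div_mul_eq_div, mul_assoc]
  gcongr

end KernelAssumption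

theorem integral_densityMeasure {f : EuclideanSpace ℝ (Fin d) → ℝ} (hf : IsDensity f)
    (ψ : EuclideanSpace ℝ (Fin d) → ℝ) :
    ∫ x, ψ x ∂densityMeasure f = ∫ x, f x * ψ x := by
  rw [densityMeasure, integral_withDensity_eq_integral_toReal_smul hf.measurable.ennreal_ofReal
    (ae_of_all _ fun _ => ENNReal.ofReal_lt_top)]
  simp_rw [ENNReal.toReal_ofReal (hf.nonneg _), smul_eq_mul]

variable {f : EuclideanSpace ℝ (Fin d) → ℝ} {c h : ℝ}

theorem IsDensity.integral_scaledKernel_le (hf : IsDensity f) (hfc : ∀ x, f x ≤ c)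
    (hK : KernelAssumption K₀ C C' C'' ε) (hh : 0 < h) (y : EuclideanSpace ℝ (Fin d)) :
    ∫ x, scaledKernel K₀ h y x ∂densityMeasure f ≤ c := by
  have hnonneg := hK.scaledKernel_nonneg hh y
  calc ∫ x, scaledKernel K₀ h y x ∂densityMeasure f = ∫ x, f x * scaledKernel K₀ h y x :=
        integral_densityMeasure hf _
    _ ≤ ∫ x, c * scaledKernel K₀ h y x :=
        integral_mono_of_nonneg (ae_of_all _ fun x => mul_nonneg (hf.nonneg x) (hnonneg x))
          ((hK.integrable_scaledKernel hh y).const_mul c)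
          (ae_of_all _ fun x => mul_le_mul_of_nonneg_right (hfc x) (hnonneg x))
    _ = c := by rw [integral_const_mul, hK.integral_scaledKernel hh, mul_one]

theorem IsDensity.integral_sq_le (hf : IsDensity f) (hfc : ∀ x, f x ≤ c)
    {ψ : EuclideanSpace ℝ (Fin d) → ℝ} (hψ : Integrable ψ) {S : ℝ} (hS : ∀ x, |ψ x| ≤ S) :
    ∫ x, ψ x ^ 2 ∂densityMeasure f ≤ c * S * ∫ x, |ψ x| := by
  rw [integral_densityMeasure hf, ← integral_const_mul]
  refine integral_mono_of_nonneg (ae_of_all _ fun x => mul_nonneg (hf.nonneg x) (sq_nonneg _))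
    (hψ.abs.const_mul _) (ae_of_all _ fun x => ?_)
  calc f x * ψ x ^ 2 = f x * (|ψ x| * |ψ x|) := by rw [← sq, sq_abs]
    _ ≤ c * (S * |ψ x|) := by
      gcongr
      exacts [(hf.nonneg x).trans (hfc x), hfc x, hS x]
    _ = c * S * |ψ x| := by ring

variable {s c' c'' : ℝ}

theorem TargetAssumption.le_const (hf : TargetAssumption f s c c' c'') (hc' : 0 ≤ c')
    (x : EuclideanSpace ℝ (Fin d)) : f x ≤ c := by
  have hexp : Real.exp (-c' * ‖x‖ ^ 2) ≤ 1 :=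
    Real.exp_le_one_iff.2 (mul_nonpos_of_nonpos_of_nonneg (neg_nonpos.2 hc') (sq_nonneg _))
  have hc : 0 ≤ c := nonneg_of_mul_nonneg_left ((hf.isDensity.nonneg x).trans (hf.subGaussian x))
    (Real.exp_pos _)
  exact (hf.subGaussian x).trans (mul_le_of_le_one_right hc hexp)

theorem rpow_le_one_add_sq {t : ℝ} (ht : 0 ≤ t) (hs : 0 ≤ s) (hs2 : s ≤ 2) :
    t ^ s ≤ 1 + t ^ 2 := by
  rcases le_total t 1 with h | h
  · linarith [Real.rpow_le_one ht h hs, sq_nonneg t]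
  · have := Real.rpow_le_rpow_of_exponent_le h hs2
    rw [Real.rpow_two] at this
    linarith

theorem TargetAssumption.exists_forall_sub_le (hf : TargetAssumption f s c c' c'') (hs : 0 ≤ s)
    (hs2 : s ≤ 2) (hc'' : 0 ≤ c'') (hh : 0 ≤ h) (y : EuclideanSpace ℝ (Fin d)) :
    ∃ a : EuclideanSpace ℝ (Fin d), ∀ v,
      f y - f (y + h • v) ≤ c'' * h ^ s * (1 + ‖v‖ ^ 2) - inner ℝ a v := by
  obtain ⟨a, ha⟩ : ∃ a : EuclideanSpace ℝ (Fin d), ∀ v,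
      (if 1 < s then inner ℝ (gradient f y) (h • v) else 0) = inner ℝ a v := by
    by_cases h1 : 1 < s
    · exact ⟨h • gradient f y, fun v => by
        rw [if_pos h1, real_inner_smul_left, real_inner_smul_right]⟩
    · exact ⟨0, fun v => by rw [if_neg h1, inner_zero_left]⟩
  refine ⟨a, fun v => ?_⟩
  have htaylor := (abs_le.1 (hf.taylor y (h • v))).1
  have hremainder : c'' * ‖h • v‖ ^ s ≤ c'' * h ^ s * (1 + ‖v‖ ^ 2) := by
    rw [norm_smul, Real.norm_eq_abs, abs_of_nonneg hh, Real.mul_rpow hh (norm_nonneg _), mul_assoc]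
    gcongr
    exact rpow_le_one_add_sq (norm_nonneg _) hs hs2
  rw [ha v] at htaylor
  linarith

theorem TargetAssumption.integrable_mul_prodKernel (hf : TargetAssumption f s c c' c'')
    (hK : KernelAssumption K₀ C C' C'' ε) (hc' : 0 ≤ c') (y : EuclideanSpace ℝ (Fin d)) :
    Integrable fun v => f (y + h • v) * prodKernel K₀ v := by
  refine Integrable.bdd_mul (c := c) hK.integrable_prodKernel
    (hf.isDensity.measurable.comp
      (measurable_const.add (measurable_id.const_smul h))).aestronglyMeasurable
    (ae_of_all _ fun v => ?_)
  rw [Real.norm_eq_abs, abs_of_nonneg (hf.isDensity.nonneg _)]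
  exact hf.le_const hc' _

theorem TargetAssumption.sub_integral_scaledKernel_le (hf : TargetAssumption f s c c' c'')
    (hK : KernelAssumption K₀ C C' C'' ε) (hs : 0 ≤ s) (hs2 : s ≤ 2) (hc' : 0 ≤ c')
    (hc'' : 0 ≤ c'') (hh : 0 < h) (y : EuclideanSpace ℝ (Fin d)) :
    f y - ∫ x, scaledKernel K₀ h y x ∂densityMeasure f ≤ c'' * (1 + d * C') * h ^ s := by
  obtain ⟨a, ha⟩ := hf.exists_forall_sub_le hs hs2 hc'' hh.le y
  have hK1 := hK.integrable_prodKernel (d := d)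
  have hK2 : Integrable fun v : EuclideanSpace ℝ (Fin d) =>
      prodKernel K₀ v + ‖v‖ ^ 2 * prodKernel K₀ v := hK1.add hK.integrable_norm_sq_mul
  have hKf := hf.integrable_mul_prodKernel (h := h) hK hc' y
  have hpointwise (v : EuclideanSpace ℝ (Fin d)) :
      f y * prodKernel K₀ v - f (y + h • v) * prodKernel K₀ v ≤
        c'' * h ^ s * (prodKernel K₀ v + ‖v‖ ^ 2 * prodKernel K₀ v) -
          inner ℝ a v * prodKernel K₀ v := by
    linarith [mul_le_mul_of_nonneg_right (ha v) (hK.prodKernel_nonneg v)]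
  have hmoment := hK.integral_norm_sq_mul_le (d := d)
  calc f y - ∫ x, scaledKernel K₀ h y x ∂densityMeasure f
      = ∫ v, (f y * prodKernel K₀ v - f (y + h • v) * prodKernel K₀ v) := by
        rw [integral_densityMeasure hf.isDensity, integral_mul_scaledKernel f hh,
          integral_sub (hK1.const_mul _) hKf, integral_const_mul, hK.integral_prodKernel, mul_one]
    _ ≤ ∫ v, (c'' * h ^ s * (prodKernel K₀ v + ‖v‖ ^ 2 * prodKernel K₀ v) -
          inner ℝ a v * prodKernel K₀ v) :=
        integral_mono ((hK1.const_mul _).sub hKf)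
          ((hK2.const_mul _).sub (hK.integrable_inner_mul a)) hpointwise
    _ = c'' * h ^ s * (1 + ∫ v : EuclideanSpace ℝ (Fin d), ‖v‖ ^ 2 * prodKernel K₀ v) := by
        rw [integral_sub (hK2.const_mul _) (hK.integrable_inner_mul a), hK.integral_inner_mul,
          integral_const_mul, integral_add hK1 hK.integrable_norm_sq_mul, hK.integral_prodKernel,
          sub_zero]
    _ ≤ c'' * h ^ s * (1 + d * C') := by gcongr
    _ = c'' * (1 + d * C') * h ^ s := by ring

end Kernel

/-! ### Deviation of the kernel estimate over nets -/

section Shortfall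

variable {Ω ι : Type*} [MeasurableSpace Ω] [Fintype ι] {ν : Measure Ω} {φ ψ : Ω → ℝ}

/-- The amount by which the sum of `ψ` over a sample falls short of its mean. -/
def shortfall (ν : Measure Ω) (ψ : Ω → ℝ) (x : ι → Ω) : ℝ :=
  ∑ j, (∫ y, ψ y ∂ν - ψ (x j))

theorem measurable_shortfall (hψ : Measurable ψ) : Measurable (shortfall (ι := ι) ν ψ) :=
  Finset.measurable_fun_sum _ fun j _ => (hψ.comp (measurable_pi_apply j)).const_sub _

theorem shortfall_eq (ν : Measure Ω) (ψ : Ω → ℝ) (x : ι → Ω) :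
    shortfall ν ψ x = Fintype.card ι * ∫ y, ψ y ∂ν - ∑ j, ψ (x j) := by
  simp [shortfall, Finset.sum_sub_distrib]

theorem shortfall_sub (hφ : Integrable φ ν) (hψ : Integrable ψ ν) (x : ι → Ω) :
    shortfall ν (fun y => φ y - ψ y) x = shortfall ν φ x - shortfall ν ψ x := by
  simp only [shortfall, integral_sub hφ hψ, ← Finset.sum_sub_distrib]
  exact Finset.sum_congr rfl fun j _ => by ring

variable [IsProbabilityMeasure ν] {S : ℝ}

theorem integral_sub_le_of_abs_le (hS : ∀ x, |ψ x| ≤ S) (x : Ω) :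
    ∫ y, ψ y ∂ν - ψ x ≤ 2 * S := by
  have hae : ∀ᵐ y ∂ν, ‖ψ y‖ ≤ S := ae_of_all _ hS
  have hmean : |∫ y, ψ y ∂ν| ≤ S := by simpa using norm_integral_le_of_norm_le_const hae
  linarith [(abs_le.1 hmean).2, (abs_le.1 (hS x)).1]

theorem shortfall_le_of_abs_le (hS : ∀ x, |ψ x| ≤ S) (x : ι → Ω) :
    shortfall ν ψ x ≤ Fintype.card ι * (2 * S) := by
  refine (Finset.sum_le_card_nsmul _ _ (2 * S) fun j _ =>
    integral_sub_le_of_abs_le hS (x j)).trans_eq ?_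
  rw [nsmul_eq_mul, Finset.card_univ]

theorem measureReal_pi_le_shortfall_le (hψ : MemLp ψ 2 ν) {b σ t : ℝ} (hσ : 0 < σ)
    (hb : ∀ x, ∫ y, ψ y ∂ν - ψ x ≤ b) (hvar : ∫ x, ψ x ^ 2 ∂ν ≤ σ) (ht : 0 ≤ t)
    (htb : t * b ≤ 2 * σ) :
    (Measure.pi fun _ : ι => ν).real {x | Fintype.card ι * t ≤ shortfall ν ψ x} ≤
      Real.exp (-(Fintype.card ι * t ^ 2 / (4 * σ))) := by
  have hint : Integrable ψ ν := hψ.integrable one_le_two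
  have hmean : ∫ x, (∫ y, ψ y ∂ν - ψ x) ∂ν = 0 := by
    simp [integral_sub (integrable_const _) hint]
  have hsq : ∫ x, (∫ y, ψ y ∂ν - ψ x) ^ 2 ∂ν ≤ σ := by
    have hvariance := variance_le_expectation_sq hψ.aestronglyMeasurable
    rw [variance_eq_integral hψ.aestronglyMeasurable.aemeasurable] at hvariance
    simp_rw [sub_sq_comm (∫ y, ψ y ∂ν)]
    exact hvariance.trans hvar
  refine (measureReal_pi_sum_ge_le (l := t / (2 * σ)) ((memLp_const _).sub hψ)
    (ae_of_all _ hb) hmean hsq (by positivity) ?_ _).trans_eq ?_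
  · rw [div_mul_eq_mul_div]
    exact div_le_one_of_le₀ htb (by positivity)
  · congr 1
    field_simp
    ring

end Shortfall

section Nets

variable {d : ℕ} {K₀ : ℝ → ℝ} {C C' C'' ε : ℝ} {f : EuclideanSpace ℝ (Fin d) → ℝ}
  {c h S t : ℝ} {y z : EuclideanSpace ℝ (Fin d)}

theorem IsDensity.measureReal_pi_le_shortfall_le (hf : IsDensity f) (hfc : ∀ x, f x ≤ c)
    (hc : 0 < c) {ψ : EuclideanSpace ℝ (Fin d) → ℝ} (hψm : Measurable ψ) (hψ : Integrable ψ)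
    {J b : ℝ} (hS0 : 0 < S) (hJ0 : 0 < J) (hS : ∀ x, |ψ x| ≤ S) (hJ : ∫ x, |ψ x| ≤ J)
    (hb : ∀ x, ∫ y, ψ y ∂densityMeasure f - ψ x ≤ b) (ht : 0 ≤ t)
    (htb : t * b ≤ 2 * (c * S * J)) (k : ℕ) :
    (Measure.pi fun _ : Fin k => densityMeasure f).real
        {x | k * t ≤ shortfall (densityMeasure f) ψ x} ≤
      Real.exp (-(k * t ^ 2 / (4 * (c * S * J)))) := by
  have := hf.isProbabilityMeasure
  have hvar : ∫ x, ψ x ^ 2 ∂densityMeasure f ≤ c * S * J :=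
    (hf.integral_sq_le hfc hψ hS).trans (mul_le_mul_of_nonneg_left hJ (by positivity))
  simpa using EPRS.measureReal_pi_le_shortfall_le (ι := Fin k)
    (.of_bound hψm.aestronglyMeasurable S (ae_of_all _ hS)) (by positivity) hb hvar ht htb

theorem KernelAssumption.integrable_scaledKernel_densityMeasure
    (hK : KernelAssumption K₀ C C' C'' ε) (hε : 0 < ε) (hf : IsDensity f) (hh : 0 < h)
    (y : EuclideanSpace ℝ (Fin d)) : Integrable (scaledKernel K₀ h y) (densityMeasure f) := by
  have := hf.isProbabilityMeasure
  exact .of_bound (measurable_scaledKernel (hK.measurable hε) h y).aestronglyMeasurable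
    (C ^ d / h ^ d) (ae_of_all _ (hK.abs_scaledKernel_le hh y))

theorem IsDensity.measureReal_pi_le_shortfall_scaledKernel_le (hf : IsDensity f)
    (hfc : ∀ x, f x ≤ c) (hc : 0 < c) (hK : KernelAssumption K₀ C C' C'' ε) (hε : 0 < ε)
    (hC : 0 < C) (hh : 0 < h) (ht : 0 ≤ t) (htb : t ≤ 2 * (C ^ d / h ^ d))
    (y : EuclideanSpace ℝ (Fin d)) (k : ℕ) :
    (Measure.pi fun _ : Fin k => densityMeasure f).real
        {x | k * t ≤ shortfall (densityMeasure f) (scaledKernel K₀ h y) x} ≤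
      Real.exp (-(k * t ^ 2 / (4 * (c * (C ^ d / h ^ d) * 1)))) := by
  refine hf.measureReal_pi_le_shortfall_le hfc hc
    (measurable_scaledKernel (hK.measurable hε) h y) (hK.integrable_scaledKernel hh y) (b := c)
    (by positivity) one_pos (hK.abs_scaledKernel_le hh y) ?_ (fun x => ?_) ht (by nlinarith) k
  · simp_rw [abs_of_nonneg (hK.scaledKernel_nonneg hh y _)]
    exact (hK.integral_scaledKernel hh y).le
  · linarith [hf.integral_scaledKernel_le hfc hK hh y, hK.scaledKernel_nonneg hh y x]

theorem KernelAssumption.integral_abs_scaledKernel_sub_le (hK : KernelAssumption K₀ C C' C'' ε)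
    (hh : 0 < h) (y z : EuclideanSpace ℝ (Fin d)) :
    ∫ x, |scaledKernel K₀ h z x - scaledKernel K₀ h y x| ≤ 2 := by
  have hy := hK.integrable_scaledKernel hh y
  have hz := hK.integrable_scaledKernel hh z
  calc ∫ x, |scaledKernel K₀ h z x - scaledKernel K₀ h y x|
      ≤ ∫ x, (scaledKernel K₀ h z x + scaledKernel K₀ h y x) :=
        integral_mono (hz.sub hy).abs (hz.add hy) fun x =>
          abs_le.2 ⟨by linarith [hK.scaledKernel_nonneg hh z x],
            by linarith [hK.scaledKernel_nonneg hh y x]⟩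
    _ = 2 := by
        rw [integral_add hz hy, hK.integral_scaledKernel hh, hK.integral_scaledKernel hh]
        norm_num

theorem IsDensity.measureReal_pi_le_shortfall_scaledKernel_sub_le (hf : IsDensity f)
    (hfc : ∀ x, f x ≤ c) (hc : 0 < c) (hK : KernelAssumption K₀ C C' C'' ε) (hε : 0 < ε)
    (hh : 0 < h) (ht : 0 ≤ t) (htb : t ≤ 2 * c) (hS0 : 0 < S)
    (hS : ∀ x, |scaledKernel K₀ h z x - scaledKernel K₀ h y x| ≤ S) (k : ℕ) :
    (Measure.pi fun _ : Fin k => densityMeasure f).real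
        {x | k * t ≤ shortfall (densityMeasure f)
          (fun u => scaledKernel K₀ h z u - scaledKernel K₀ h y u) x} ≤
      Real.exp (-(k * t ^ 2 / (4 * (c * S * 2)))) := by
  have := hf.isProbabilityMeasure
  exact hf.measureReal_pi_le_shortfall_le hfc hc
    ((measurable_scaledKernel (hK.measurable hε) h z).sub
      (measurable_scaledKernel (hK.measurable hε) h y))
    ((hK.integrable_scaledKernel hh z).sub (hK.integrable_scaledKernel hh y)) hS0 two_pos hS
    (hK.integral_abs_scaledKernel_sub_le hh y z) (integral_sub_le_of_abs_le hS) ht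
    (by nlinarith) k

theorem measureReal_biUnion_finset_le_card_mul {Ω ι : Type*} [MeasurableSpace Ω] {μ : Measure Ω}
    (P : Finset ι) {A : ι → Set Ω} {b : ℝ} (hA : ∀ i ∈ P, μ.real (A i) ≤ b) :
    μ.real (⋃ i ∈ P, A i) ≤ P.card * b := by
  rw [← nsmul_eq_mul]
  exact (measureReal_biUnion_finset_le _ _).trans (Finset.sum_le_card_nsmul _ _ _ hA)

/- Chaining in two steps: the variance bound for the kernel itself only supports a coarse net `P`,
while the small increments from `P` to the fine net `Q` have a much smaller variance. -/
theorem IsDensity.exists_shortfall_le_of_nets (hf : IsDensity f) (hfc : ∀ x, f x ≤ c)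
    (hc : 0 < c) (hK : KernelAssumption K₀ C C' C'' ε) (hε : 0 < ε) (hC : 0 < C) (hh : 0 < h)
    {t₀ t₁ : ℝ} (ht₀ : 0 ≤ t₀) (ht₁ : 0 ≤ t₁) (htb₀ : t₀ ≤ 2 * (C ^ d / h ^ d))
    (htb₁ : t₁ ≤ 2 * c) {P Q : Finset (EuclideanSpace ℝ (Fin d))}
    {π : EuclideanSpace ℝ (Fin d) → EuclideanSpace ℝ (Fin d)} (hπ : ∀ z ∈ Q, π z ∈ P)
    (hS0 : 0 < S) (hS : ∀ z ∈ Q, ∀ x, |scaledKernel K₀ h z x - scaledKernel K₀ h (π z) x| ≤ S)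
    (k : ℕ) :
    ∃ G : Set (Fin k → EuclideanSpace ℝ (Fin d)), MeasurableSet G ∧
      (Measure.pi fun _ => densityMeasure f).real Gᶜ ≤
        P.card * Real.exp (-(k * t₀ ^ 2 / (4 * (c * (C ^ d / h ^ d) * 1)))) +
        Q.card * Real.exp (-(k * t₁ ^ 2 / (4 * (c * S * 2)))) ∧
      ∀ x ∈ G, ∀ z ∈ Q,
        shortfall (densityMeasure f) (scaledKernel K₀ h z) x ≤ k * (t₀ + t₁) := by
  have := hf.isProbabilityMeasure
  have hm := measurable_scaledKernel (d := d) (hK.measurable hε) h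
  have hint := hK.integrable_scaledKernel_densityMeasure hε hf hh
  let A (y : EuclideanSpace ℝ (Fin d)) : Set (Fin k → EuclideanSpace ℝ (Fin d)) :=
    {x | k * t₀ ≤ shortfall (densityMeasure f) (scaledKernel K₀ h y) x}
  let B (z : EuclideanSpace ℝ (Fin d)) : Set (Fin k → EuclideanSpace ℝ (Fin d)) :=
    {x | k * t₁ ≤ shortfall (densityMeasure f)
      (fun u => scaledKernel K₀ h z u - scaledKernel K₀ h (π z) u) x}
  have hA (y) : MeasurableSet (A y) :=
    measurableSet_le measurable_const (measurable_shortfall (hm y))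
  have hB (z) : MeasurableSet (B z) :=
    measurableSet_le measurable_const (measurable_shortfall ((hm z).sub (hm (π z))))
  refine ⟨((⋃ y ∈ P, A y) ∪ ⋃ z ∈ Q, B z)ᶜ, ?_, ?_, fun x hx z hz => ?_⟩
  · exact ((P.measurableSet_biUnion fun y _ => hA y).union
      (Q.measurableSet_biUnion fun z _ => hB z)).compl
  · rw [compl_compl]
    exact (measureReal_union_le _ _).trans (add_le_add
      (measureReal_biUnion_finset_le_card_mul P fun y _ =>
        hf.measureReal_pi_le_shortfall_scaledKernel_le hfc hc hK hε hC hh ht₀ htb₀ y k)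
      (measureReal_biUnion_finset_le_card_mul Q fun z hz =>
        hf.measureReal_pi_le_shortfall_scaledKernel_sub_le hfc hc hK hε hh ht₁ htb₁ hS0
          (hS z hz) k))
  · simp only [Set.compl_union, Set.mem_inter_iff, Set.mem_compl_iff, Set.mem_iUnion, not_exists,
      A, B, Set.mem_ofPred_eq, not_le, shortfall_sub (hint _) (hint _)] at hx
    linarith [hx.1 (π z) (hπ z hz), hx.2 z hz]

theorem TargetAssumption.le_average_add (hK : KernelAssumption K₀ C C' C'' ε) {s c' c'' : ℝ}
    (hf : TargetAssumption f s c c' c'') (hε : 0 < ε) (hs : 0 ≤ s) (hs2 : s ≤ 2) (hc' : 0 ≤ c')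
    (hc'' : 0 ≤ c'') (hh : 0 < h)
    (hS : ∀ x, |scaledKernel K₀ h y x - scaledKernel K₀ h z x| ≤ S) {k : ℕ} (hk : 0 < k)
    {x : Fin k → EuclideanSpace ℝ (Fin d)}
    (hx : shortfall (densityMeasure f) (scaledKernel K₀ h z) x ≤ k * t) :
    f y ≤ 1 / k * ∑ j, scaledKernel K₀ h y (x j) + (c'' * (1 + d * C') * h ^ s + t + 2 * S) := by
  have := hf.isDensity.isProbabilityMeasure
  have hint := hK.integrable_scaledKernel_densityMeasure hε hf.isDensity hh
  have hbias := hf.sub_integral_scaledKernel_le hK hs hs2 hc' hc'' hh y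
  have hincrement := shortfall_le_of_abs_le (ν := densityMeasure f) hS x
  rw [shortfall_sub (hint y) (hint z), shortfall_eq _ (scaledKernel K₀ h y), Fintype.card_fin]
    at hincrement
  have hfluctuation : ∫ u, scaledKernel K₀ h y u ∂densityMeasure f -
      1 / k * ∑ j, scaledKernel K₀ h y (x j) ≤ t + 2 * S := by
    have hk0 : (0 : ℝ) < k := Nat.cast_pos.2 hk
    rw [← mul_le_mul_iff_of_pos_left hk0, mul_sub, ← mul_assoc, mul_one_div_cancel hk0.ne',
      one_mul]
    linarith
  linarith

end Nets

section Grid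

variable {d : ℕ}

/-- The point of the grid of mesh `1 / q` with integer coordinates `a`. -/
def gridPoint (q : ℕ) (a : Fin d → ℤ) : EuclideanSpace ℝ (Fin d) :=
  WithLp.toLp 2 fun i => (a i : ℝ) / q

open Classical in
/-- The grid of mesh `1 / q` in the centred cube of side `2 R`. -/
def grid (d q R : ℕ) : Finset (EuclideanSpace ℝ (Fin d)) :=
  (Fintype.piFinset fun _ : Fin d => Finset.Icc (-(R * q : ℕ) : ℤ) (R * q : ℕ)).image (gridPoint q)

/-- Rounding down to the grid of mesh `1 / q`. -/
def roundGrid (q : ℕ) (x : EuclideanSpace ℝ (Fin d)) : EuclideanSpace ℝ (Fin d) :=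
  gridPoint q fun i => ⌊x i * q⌋

theorem card_grid_le (q R : ℕ) : (grid d q R).card ≤ (2 * (R * q) + 1) ^ d := by
  refine Finset.card_image_le.trans ?_
  rw [Fintype.card_piFinset, Finset.prod_const, Finset.card_univ, Fintype.card_fin, Int.card_Icc]
  exact Nat.pow_le_pow_left (by omega) d

theorem roundGrid_mem {q R : ℕ} {x : EuclideanSpace ℝ (Fin d)}
    (hx : ∀ i, |x i| ≤ R) : roundGrid q x ∈ grid d q R := by
  refine Finset.mem_image_of_mem _ (Fintype.mem_piFinset.2 fun i => Finset.mem_Icc.2 ⟨?_, ?_⟩)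
  · rw [Int.le_floor]
    push_cast
    rw [← neg_mul]
    exact mul_le_mul_of_nonneg_right (abs_le.1 (hx i)).1 (Nat.cast_nonneg q)
  · have hfloor : ((⌊x i * q⌋ : ℤ) : ℝ) ≤ ((R * q : ℕ) : ℤ) := by
      refine (Int.floor_le _).trans ?_
      push_cast
      exact mul_le_mul_of_nonneg_right (abs_le.1 (hx i)).2 (Nat.cast_nonneg q)
    exact_mod_cast hfloor

theorem abs_sub_roundGrid_le {q : ℕ} (hq : 0 < q) (x : EuclideanSpace ℝ (Fin d)) (i : Fin d) :
    |x i - roundGrid q x i| ≤ 1 / q := by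
  have hq' : (0 : ℝ) < q := Nat.cast_pos.2 hq
  have hfract : x i - roundGrid q x i = Int.fract (x i * q) / q := by
    simp only [roundGrid, gridPoint, Int.fract]
    field_simp
  rw [hfract, abs_of_nonneg (div_nonneg (Int.fract_nonneg _) hq'.le)]
  exact div_le_div_of_nonneg_right (Int.fract_lt_one _).le hq'.le

theorem abs_le_of_mem_grid {q R : ℕ} (hq : 0 < q) {z : EuclideanSpace ℝ (Fin d)}
    (hz : z ∈ grid d q R) (i : Fin d) : |z i| ≤ R := by
  have hq' : (0 : ℝ) < q := Nat.cast_pos.2 hq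
  obtain ⟨a, ha, rfl⟩ := Finset.mem_image.1 hz
  have hai : |a i| ≤ (R * q : ℕ) := abs_le.2 (Finset.mem_Icc.1 (Fintype.mem_piFinset.1 ha i))
  simp only [gridPoint]
  rw [abs_div, abs_of_pos hq', div_le_iff₀ hq']
  exact_mod_cast hai

end Grid

/-! ### The bandwidth and the uniform bound for the kernel estimate -/

section Bandwidth

variable {d k : ℕ} {s δ : ℝ}

theorem one_le_log (hk : 3 ≤ k) : 1 ≤ Real.log k := by
  have hk' : (3 : ℝ) ≤ k := by exact_mod_cast hk
  rw [Real.le_log_iff_exp_le (by linarith)]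
  linarith [Real.exp_one_lt_d9]

theorem log_le_log_div {x : ℝ} (hδ : 0 < δ) (hδ1 : δ ≤ 1) (hx : 0 < x) :
    Real.log x ≤ Real.log (x / δ) :=
  Real.log_le_log hx (le_div_self hx.le hδ hδ1)

theorem tendsto_bandwidth (d : ℕ) (hs : 0 < s) (hδ : 0 < δ) :
    Tendsto (fun k => bandwidth d s δ k) atTop (𝓝 0) := by
  have hlog := (Real.tendsto_pow_log_div_mul_add_atTop δ 0 1 hδ.ne').comp
    (tendsto_natCast_atTop_atTop.atTop_div_const hδ)
  have hbase : Tendsto (fun k : ℕ => Real.log (k / δ) / k) atTop (𝓝 0) := by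
    refine hlog.congr fun k => ?_
    simp only [Function.comp_apply, pow_one, add_zero]
    rw [mul_div_cancel₀ _ hδ.ne']
  have hpow := hbase.rpow_const (p := 1 / (2 * s + d)) (.inr (by positivity))
  rwa [Real.zero_rpow (by positivity)] at hpow

theorem eventually_mul_bandwidth_rpow_le (d : ℕ) (hs : 0 < s) (hδ : 0 < δ) (A : ℝ) {b : ℝ}
    (hb : 0 < b) : ∀ᶠ k in atTop, A * bandwidth d s δ k ^ s ≤ b := by
  have hpow := ((tendsto_bandwidth d hs hδ).rpow_const (p := s) (.inr hs.le)).const_mul A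
  rw [Real.zero_rpow hs.ne', mul_zero] at hpow
  exact hpow.eventually_le_const hb

theorem bandwidth_pos (hk : 0 < k) (hL : 0 < Real.log (k / δ)) : 0 < bandwidth d s δ k :=
  Real.rpow_pos_of_pos (div_pos hL (Nat.cast_pos.2 hk)) _

theorem mul_bandwidth_rpow (hs : 0 < s) (hk : 0 < k) (hL : 0 < Real.log (k / δ)) :
    k * ((bandwidth d s δ k ^ s) ^ 2 * bandwidth d s δ k ^ d) = Real.log (k / δ) := by
  have : (0 : ℝ) < k := Nat.cast_pos.2 hk
  have hh := bandwidth_pos (d := d) (s := s) hk hL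
  have hexp : 1 / (2 * s + d) * (s * ((2 : ℕ) : ℝ) + d) = 1 := by
    push_cast
    field_simp
  rw [← Real.rpow_natCast (bandwidth d s δ k) d, ← Real.rpow_natCast (bandwidth d s δ k ^ s) 2,
    ← Real.rpow_mul hh.le, ← Real.rpow_add hh, bandwidth, ← Real.rpow_mul (by positivity), hexp,
    Real.rpow_one]
  field_simp

theorem rpow_le_bandwidth (hs : 0 < s) (hL : 1 ≤ Real.log (k / δ)) :
    (k : ℝ) ^ (-(1 / (2 * s + d))) ≤ bandwidth d s δ k := by
  rw [Real.rpow_neg k.cast_nonneg, ← Real.inv_rpow k.cast_nonneg, inv_eq_one_div, bandwidth]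
  gcongr

theorem one_div_le_bandwidth (hd : 1 ≤ d) (hs : 0 < s) (hk : 0 < k)
    (hL : 1 ≤ Real.log (k / δ)) : 1 / (k : ℝ) ≤ bandwidth d s δ k := by
  have hd' : (1 : ℝ) ≤ d := by exact_mod_cast hd
  refine le_trans ?_ (rpow_le_bandwidth hs hL)
  rw [one_div, ← Real.rpow_neg_one]
  refine Real.rpow_le_rpow_of_exponent_le (by exact_mod_cast hk) (neg_le_neg ?_)
  rw [div_le_one (by positivity)]
  linarith

theorem tendsto_one_div_div_bandwidth (hd : 1 ≤ d) (hs : 0 < s) (hδ : 0 < δ) (hδ1 : δ ≤ 1) :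
    Tendsto (fun k : ℕ => 1 / (k : ℝ) / bandwidth d s δ k) atTop (𝓝 0) := by
  have hd' : (1 : ℝ) ≤ d := by exact_mod_cast hd
  have hexp : 0 < 1 - 1 / (2 * s + d) := by
    rw [sub_pos, div_lt_one (by positivity)]
    linarith
  refine squeeze_zero' ?_ ?_ ((tendsto_rpow_neg_atTop hexp).comp tendsto_natCast_atTop_atTop)
  all_goals
    filter_upwards [eventually_ge_atTop 3] with k hk
    have hk0 : (0 : ℝ) < k := Nat.cast_pos.2 (by omega)
    have hL := (one_le_log hk).trans (log_le_log_div hδ hδ1 hk0)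
    have hh := bandwidth_pos (d := d) (s := s) (Nat.cast_pos.1 hk0) (one_pos.trans_le hL)
  · positivity
  · rw [div_le_iff₀ hh]
    calc 1 / (k : ℝ) = (k : ℝ) ^ (-(1 - 1 / (2 * s + d))) * (k : ℝ) ^ (-(1 / (2 * s + d))) := by
          rw [← Real.rpow_add hk0, one_div, ← Real.rpow_neg_one]
          congr 1
          ring
      _ ≤ _ := mul_le_mul_of_nonneg_left (rpow_le_bandwidth hs hL) (by positivity)

end Bandwidth

section Rates

variable {d k B : ℕ} {s δ ε : ℝ}

theorem card_grid_mul_exp_le (hd : 1 ≤ d) (hk : 3 ≤ k) {E : ℝ}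
    (hE : (B + 2) * d * Real.log k ≤ E) :
    ((grid d (k ^ B) k).card : ℝ) * Real.exp (-E) ≤ 3 / k := by
  have hk' : (3 : ℝ) ≤ k := by exact_mod_cast hk
  have hk0 : (0 : ℝ) < k := by linarith
  have hcard : ((grid d (k ^ B) k).card : ℝ) ≤ (3 * (k : ℝ) ^ (B + 1)) ^ d := by
    have hgrid : ((grid d (k ^ B) k).card : ℝ) ≤ (2 * (k * (k : ℝ) ^ B) + 1) ^ d := by
      exact_mod_cast card_grid_le (k ^ B) k
    refine hgrid.trans (pow_le_pow_left₀ (by positivity) ?_ d)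
    have hone : (1 : ℝ) ≤ (k : ℝ) ^ (B + 1) := one_le_pow₀ (by linarith)
    rw [pow_succ'] at hone ⊢
    linarith
  have hexp : Real.exp (-E) ≤ (((k : ℝ) ^ (B + 2))⁻¹) ^ d := by
    calc Real.exp (-E) ≤ Real.exp (-((((B + 2) * d : ℕ) : ℝ) * Real.log k)) := by
          apply Real.exp_le_exp.2
          push_cast
          linarith
      _ = _ := by rw [Real.exp_neg, Real.exp_nat_mul, Real.exp_log hk0, pow_mul, inv_pow]
  calc _ ≤ (3 * (k : ℝ) ^ (B + 1)) ^ d * (((k : ℝ) ^ (B + 2))⁻¹) ^ d := by gcongr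
    _ = (3 / k) ^ d := by
        rw [← mul_pow]
        congr 1
        field_simp
        ring
    _ ≤ 3 / k := pow_le_of_le_one (by positivity) ((div_le_one hk0).2 hk') (by omega)

theorem card_grid_mul_exp_coarse_le (hd : 1 ≤ d) (hs : 0 < s) (hδ : 0 < δ) (hδ1 : δ ≤ 1)
    (hk : 3 ≤ k) {R c A : ℝ} (hR : R ^ 2 = c * A) (hc : c ≠ 0) (hA : A ≠ 0) :
    ((grid d k k).card : ℝ) * Real.exp (-(k * (8 * d * (R * bandwidth d s δ k ^ s)) ^ 2 /
      (4 * (c * (A / bandwidth d s δ k ^ d) * 1)))) ≤ 3 / k := by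
  have hd' : (1 : ℝ) ≤ d := by exact_mod_cast hd
  have hk0 : (0 : ℝ) < k := Nat.cast_pos.2 (by omega)
  have hlog := one_le_log hk
  have hlogδ := log_le_log_div hδ hδ1 hk0
  have hL : 0 < Real.log (k / δ) := by linarith
  have hh := bandwidth_pos (d := d) (s := s) (Nat.cast_pos.1 hk0) hL
  have hexponent : k * (8 * d * (R * bandwidth d s δ k ^ s)) ^ 2 /
      (4 * (c * (A / bandwidth d s δ k ^ d) * 1)) = 16 * d ^ 2 * Real.log (k / δ) := by
    rw [← mul_bandwidth_rpow (d := d) hs (Nat.cast_pos.1 hk0) hL, mul_pow, mul_pow R, hR]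
    field_simp
    ring
  rw [hexponent]
  nth_rewrite 1 [← pow_one k]
  refine card_grid_mul_exp_le hd hk ?_
  push_cast
  calc (1 + 2) * d * Real.log k ≤ 16 * d ^ 2 * Real.log k := by
        gcongr
        · norm_num
        · exact le_self_pow₀ hd' two_ne_zero
    _ ≤ _ := by gcongr

theorem card_grid_mul_exp_fine_le (hd : 1 ≤ d) (hs : 0 < s) (hδ : 0 < δ) (hδ1 : δ ≤ 1)
    (hk : 3 ≤ k) {R c A Q : ℝ} (hR : R ^ 2 = c * A) (hc : c ≠ 0) (hQ : 0 < Q)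
    (hAQ : (B + 2) * d * (8 * Q) ≤ A) :
    ((grid d (k ^ B) k).card : ℝ) * Real.exp (-(k * (R * bandwidth d s δ k ^ s) ^ 2 /
      (4 * (c * (Q / bandwidth d s δ k ^ d) * 2)))) ≤ 3 / k := by
  have hk0 : (0 : ℝ) < k := Nat.cast_pos.2 (by omega)
  have hlog := one_le_log hk
  have hlogδ := log_le_log_div hδ hδ1 hk0
  have hL : 0 < Real.log (k / δ) := by linarith
  have hh := bandwidth_pos (d := d) (s := s) (Nat.cast_pos.1 hk0) hL
  have hexponent : k * (R * bandwidth d s δ k ^ s) ^ 2 /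
      (4 * (c * (Q / bandwidth d s δ k ^ d) * 2)) = A / (8 * Q) * Real.log (k / δ) := by
    rw [← mul_bandwidth_rpow (d := d) hs (Nat.cast_pos.1 hk0) hL, mul_pow, hR]
    field_simp
    ring
  rw [hexponent]
  exact card_grid_mul_exp_le hd hk (mul_le_mul ((le_div_iff₀ (by positivity)).2 hAQ) hlogδ
    (by linarith) (div_nonneg (le_trans (by positivity) hAQ) (by positivity)))

theorem fine_increment_le (hs : 0 < s) (hε : 0 < ε) {D R h : ℝ} (hD : 0 ≤ D)
    (hB : d + s + 1 ≤ ((B : ℝ) - 1) * ε) (hk : 0 < k) (hh : 1 / (k : ℝ) ≤ h)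
    (hR : 2 * D * (1 / k) ≤ R) :
    2 * (D * (1 / ((k ^ B : ℕ) : ℝ) / h) ^ ε / h ^ d) ≤ R * h ^ s := by
  have hk0 : (0 : ℝ) < k := Nat.cast_pos.2 hk
  have hh0 : 0 < h := lt_of_lt_of_le (by positivity) hh
  have hmesh : 1 / ((k ^ B : ℕ) : ℝ) / h ≤ (k : ℝ) ^ (-((B : ℝ) - 1)) := by
    rw [div_le_iff₀ hh0]
    calc 1 / ((k ^ B : ℕ) : ℝ) = (k : ℝ) ^ (-((B : ℝ) - 1)) * (1 / k) := by
          push_cast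
          rw [one_div, one_div, ← Real.rpow_neg_one (k : ℝ), ← Real.rpow_add hk0,
            ← Real.rpow_natCast, ← Real.rpow_neg hk0.le]
          congr 1
          ring
      _ ≤ _ := by gcongr
  have hholder : (1 / ((k ^ B : ℕ) : ℝ) / h) ^ ε ≤ (k : ℝ) ^ (-(d + s + 1 : ℝ)) := by
    refine (Real.rpow_le_rpow (by positivity) hmesh hε.le).trans ?_
    rw [← Real.rpow_mul hk0.le]
    exact Real.rpow_le_rpow_of_exponent_le (by exact_mod_cast hk) (by linarith)
  have hvolume : (h ^ d)⁻¹ ≤ (k : ℝ) ^ (d : ℝ) := by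
    rw [Real.rpow_natCast, ← inv_pow]
    refine pow_le_pow_left₀ (by positivity) ?_ d
    rwa [inv_le_comm₀ hh0 hk0, ← one_div]
  have hrate : (k : ℝ) ^ (-s) ≤ h ^ s := by
    rw [Real.rpow_neg hk0.le, ← Real.inv_rpow hk0.le, ← one_div]
    exact Real.rpow_le_rpow (by positivity) hh hs.le
  calc _ = 2 * D * ((1 / ((k ^ B : ℕ) : ℝ) / h) ^ ε * (h ^ d)⁻¹) := by rw [div_eq_mul_inv]; ring
    _ ≤ 2 * D * ((k : ℝ) ^ (-(d + s + 1 : ℝ)) * (k : ℝ) ^ (d : ℝ)) := by gcongr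
    _ = 2 * D * (1 / k) * (k : ℝ) ^ (-s) := by
        rw [← Real.rpow_add hk0, show (-(d + s + 1 : ℝ) + d) = -1 + -s by ring,
          Real.rpow_add hk0, Real.rpow_neg_one]
        ring
    _ ≤ R * h ^ s := mul_le_mul hR hrate (by positivity) (le_trans (by positivity) hR)

end Rates

section UniformBound

variable {d : ℕ} {K₀ : ℝ → ℝ} {f : EuclideanSpace ℝ (Fin d) → ℝ}
  {s C C' C'' ε c c' c'' δ : ℝ}

/-- The deviation of a kernel estimate based on a sample of size `k` that the uniform bound
allows, in units of `bandwidth ^ s`: the bias and the fluctuation. -/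
def uniformConst (d : ℕ) (c c'' C C' : ℝ) : ℝ :=
  c'' * (1 + d * C') + (8 * d + 2) * √(c * C ^ d)

theorem TargetAssumption.exists_uniform_event (hd : 1 ≤ d) (hK : KernelAssumption K₀ C C' C'' ε)
    (hf : TargetAssumption f s c c' c'') (hs : 0 < s) (hs2 : s ≤ 2) (hC : 0 < C) (hC'' : 0 < C'')
    (hε : 0 < ε) (hc : 0 < c) (hc' : 0 ≤ c') (hc'' : 0 ≤ c'') (hδ : 0 < δ) (hδ1 : δ ≤ 1)
    {k B : ℕ} {R D : ℝ} (hR0 : 0 < R) (hR : R ^ 2 = c * C ^ d)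
    (hD : D = d * C ^ (d - 1) * C'') (hk : 3 ≤ k)
    (hB : d + s + 1 ≤ ((B : ℝ) - 1) * ε) (hh1 : bandwidth d s δ k ≤ 1)
    (ht₀ : 8 * d * (R * bandwidth d s δ k ^ s) ≤ 2 * C ^ d)
    (ht₁ : R * bandwidth d s δ k ^ s ≤ 2 * c)
    (hfine : (B + 2) * d * (8 * (D * (1 / k / bandwidth d s δ k) ^ ε)) ≤ C ^ d)
    (hRk : 2 * D * (1 / k) ≤ R) :
    ∃ G : Set (Fin k → EuclideanSpace ℝ (Fin d)), MeasurableSet G ∧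
      (Measure.pi fun _ => densityMeasure f).real Gᶜ ≤ 3 / k + 3 / k ∧
      ∀ x ∈ G, ∀ y, ‖y‖ ≤ Real.log k →
        f y ≤ 1 / k * ∑ j, scaledKernel K₀ (bandwidth d s δ k) y (x j) +
          (c'' * (1 + d * C') + (8 * d + 2) * R) * bandwidth d s δ k ^ s := by
  have hk0 : 0 < k := by omega
  have hL : 1 ≤ Real.log (k / δ) :=
    (one_le_log hk).trans (log_le_log_div hδ hδ1 (Nat.cast_pos.2 hk0))
  have hh := bandwidth_pos (d := d) (s := s) hk0 (one_pos.trans_le hL)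
  have hD0 : 0 < D := hD ▸ by positivity
  have hQ : 0 < D * (1 / k / bandwidth d s δ k) ^ ε := by positivity
  obtain ⟨G, hGm, hGp, hG⟩ := hf.isDensity.exists_shortfall_le_of_nets (hf.le_const hc') hc hK hε
    hC hh (t₀ := 8 * d * (R * bandwidth d s δ k ^ s)) (t₁ := R * bandwidth d s δ k ^ s)
    (by positivity) (by positivity)
    (ht₀.trans (mul_le_mul_of_nonneg_left (le_div_self (by positivity) (by positivity)
      (pow_le_one₀ hh.le hh1)) two_pos.le)) ht₁
    (P := grid d k k) (Q := grid d (k ^ B) k) (π := roundGrid k)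
    (fun z hz => roundGrid_mem (abs_le_of_mem_grid (pow_pos hk0 B) hz))
    (div_pos hQ (by positivity))
    (fun z _ x => hD ▸ hK.abs_scaledKernel_sub_le hC''.le hε.le hh (abs_sub_roundGrid_le hk0 z) x) k
  refine ⟨G, hGm, hGp.trans (add_le_add
    (card_grid_mul_exp_coarse_le hd hs hδ hδ1 hk hR hc.ne' (by positivity))
    (card_grid_mul_exp_fine_le hd hs hδ hδ1 hk hR hc.ne' hQ hfine)), fun x hx y hy => ?_⟩
  have hmem : roundGrid (k ^ B) y ∈ grid d (k ^ B) k := roundGrid_mem fun i =>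
    (PiLp.norm_apply_le y i).trans (hy.trans (Real.log_le_self k.cast_nonneg))
  have hbound := hf.le_average_add hK hε hs.le hs2 hc' hc'' hh
    (hK.abs_scaledKernel_sub_le hC''.le hε.le hh (abs_sub_roundGrid_le (pow_pos hk0 B) y)) hk0
    (hG x hx _ hmem)
  have hincrement := fine_increment_le hs hε hD0.le hB hk0
    (one_div_le_bandwidth hd hs hk0 hL) hRk
  rw [← hD] at hbound
  linarith

theorem eventually_exists_uniform_event (hd : 1 ≤ d) (hs : 0 < s) (hs2 : s ≤ 2) (hC : 0 < C)
    (hC'' : 0 < C'') (hε : 0 < ε) (hc : 0 < c) (hc' : 0 ≤ c') (hc'' : 0 ≤ c'') (hδ : 0 < δ)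
    (hδ1 : δ ≤ 1) {η : ℝ} (hη : 0 < η) :
    ∀ᶠ k : ℕ in atTop, ∀ (K₀ : ℝ → ℝ) (f : EuclideanSpace ℝ (Fin d) → ℝ),
      KernelAssumption K₀ C C' C'' ε → TargetAssumption f s c c' c'' →
      ∃ G : Set (Fin k → EuclideanSpace ℝ (Fin d)), MeasurableSet G ∧
        (Measure.pi fun _ => densityMeasure f).real Gᶜ ≤ η ∧
        ∀ x ∈ G, ∀ y, ‖y‖ ≤ Real.log k →
          f y ≤ 1 / k * ∑ j, scaledKernel K₀ (bandwidth d s δ k) y (x j) +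
            uniformConst d c c'' C C' * bandwidth d s δ k ^ s := by
  let R := √(c * C ^ d)
  set D := d * C ^ (d - 1) * C'' with hD
  have hR0 : 0 < R := Real.sqrt_pos.2 (by positivity)
  obtain ⟨B, hB⟩ := exists_nat_ge ((d + s + 1) / ε + 1)
  have hBε : d + s + 1 ≤ ((B : ℝ) - 1) * ε := by
    rw [← div_le_iff₀ hε]
    linarith
  have hfine := ((tendsto_one_div_div_bandwidth hd hs hδ hδ1).rpow_const (p := ε)
    (.inr hε.le)).const_mul ((B + 2) * d * (8 * D))
  rw [Real.zero_rpow hε.ne', mul_zero] at hfine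
  have hsmall (A : ℝ) {b : ℝ} (hb : 0 < b) : ∀ᶠ k : ℕ in atTop, A * (1 / (k : ℝ)) ≤ b :=
    (tendsto_one_div_atTop_nhds_zero_nat.const_mul A).eventually_le_const (by rwa [mul_zero])
  filter_upwards [eventually_ge_atTop 3, (tendsto_bandwidth d hs hδ).eventually_le_const one_pos,
    eventually_mul_bandwidth_rpow_le d hs hδ (8 * d * R) (by positivity : 0 < 2 * C ^ d),
    eventually_mul_bandwidth_rpow_le d hs hδ R (by positivity : 0 < 2 * c),
    hfine.eventually_le_const (by positivity : 0 < C ^ d), hsmall (2 * D) hR0, hsmall 6 hη]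
    with k hk hh1 ht₀ ht₁ hfine hRk hηk K₀ f hK hf
  obtain ⟨G, hGm, hGp, hG⟩ := hf.exists_uniform_event hd hK hs hs2 hC hC'' hε hc hc' hc'' hδ hδ1
    hR0 (Real.sq_sqrt (by positivity)) hD hk hBε hh1 (by linarith) ht₁ (by linarith) hRk
  exact ⟨G, hGm, hGp.trans ((by ring : (3 : ℝ) / k + 3 / k = 6 * (1 / k)).trans_le hηk), hG⟩

theorem vConst_nonneg (hs : 0 < s) (hε : 0 < ε) (hc : 0 ≤ c) (hc'' : 0 ≤ c'') (hC'' : 0 ≤ C'') :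
    0 ≤ vConst s ε c c'' C'' := by
  have hlog {x : ℝ} (hx : 0 ≤ x) : 0 ≤ Real.log (1 + 1 / x) :=
    Real.log_nonneg (le_add_of_nonneg_right (by positivity))
  have : 0 < min 1 s := lt_min one_pos hs
  exact add_nonneg (mul_nonneg (hlog (by positivity)) (by positivity))
    (mul_nonneg (by positivity) (hlog (by positivity)))

theorem uniformConst_le_H₁ (hd : 1 ≤ d) (hs : 0 < s) (hε : 0 < ε) (hC : 0 ≤ C) (hC' : 0 ≤ C')
    (hC'' : 0 ≤ C'') (hc : 0 ≤ c) (hc'' : 0 ≤ c'') :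
    uniformConst d c c'' C C' ≤ H₁ d s ε c c'' C C' C'' := by
  have hd' : (1 : ℝ) ≤ d := by exact_mod_cast hd
  have hv := vConst_nonneg hs hε hc hc'' hC''
  have hbias : c'' * (1 + d * C') ≤ c'' * (1 + C') * d := by nlinarith
  have hbias0 : 0 ≤ c'' * (1 + C') * d := by positivity
  have hR := Real.sqrt_nonneg (c * C ^ d)
  have hCd : 0 ≤ C ^ d := by positivity
  calc uniformConst d c c'' C C'
      ≤ 8 * d * 1 * (2 * √(c * C ^ d) + c'' * (1 + C') * d + C ^ d) := by
        rw [uniformConst]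
        nlinarith
    _ ≤ _ := by
        rw [H₁]
        gcongr
        linarith

end UniformBound

/-! ### The initial stage -/

section StageOne

variable {d n T : ℕ} {f g e : EuclideanSpace ℝ (Fin d) → ℝ} {s M δ b : ℝ}
  {Γ : ∀ k : ℕ, Set (Fin k → EuclideanSpace ℝ (Fin d))}

/-- The event that more than `b` points are accepted and that, if there are `k` of them, they form
an element of `Γ k`: this transports events about `k` independent draws from `f` to the outcomes of
rejection sampling. -/
def goodEvent (f e : EuclideanSpace ℝ (Fin d) → ℝ) (b : ℝ)
    (Γ : ∀ k : ℕ, Set (Fin k → EuclideanSpace ℝ (Fin d))) :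
    Set (Fin T → EuclideanSpace ℝ (Fin d) × ℝ) :=
  {w | b < (accepted f e w).card ∧ output f e w rfl ∈ Γ (accepted f e w).card}

theorem goodEvent_eq_iUnion (f e : EuclideanSpace ℝ (Fin d) → ℝ) (b : ℝ)
    (Γ : ∀ k : ℕ, Set (Fin k → EuclideanSpace ℝ (Fin d))) :
    (goodEvent f e b Γ : Set (Fin T → EuclideanSpace ℝ (Fin d) × ℝ)) =
      ⋃ k : {k : ℕ // b < k},
        {w | ∃ h : (accepted f e w).card = k, output f e w h ∈ Γ k} := by
  ext w
  simp only [goodEvent, Set.mem_ofPred_eq, Set.mem_iUnion]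
  constructor
  · rintro ⟨hb, hw⟩
    exact ⟨⟨_, hb⟩, rfl, hw⟩
  · rintro ⟨⟨k, hb⟩, hk, hw⟩
    obtain rfl : _ = k := hk
    exact ⟨hb, hw⟩

theorem measurableSet_output_mem {k : ℕ} (hf : Measurable f) (he : Measurable e)
    {B : Set (Fin k → EuclideanSpace ℝ (Fin d))} (hB : MeasurableSet B) :
    MeasurableSet {w : Fin T → EuclideanSpace ℝ (Fin d) × ℝ |
      ∃ h : (accepted f e w).card = k, output f e w h ∈ B} :=
  measurableSet_selected_mem measurable_fst (measurableSet_acceptSet hf he) hB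

theorem measurableSet_goodEvent (hf : Measurable f) (he : Measurable e)
    (hΓ : ∀ k : ℕ, b < k → MeasurableSet (Γ k)) :
    MeasurableSet (goodEvent f e b Γ : Set (Fin T → EuclideanSpace ℝ (Fin d) × ℝ)) := by
  rw [goodEvent_eq_iUnion]
  exact MeasurableSet.iUnion fun k => measurableSet_output_mem hf he (hΓ k k.2)

theorem OutputIID.mul_le_goodEvent {P : Measure (Fin T → EuclideanSpace ℝ (Fin d) × ℝ)}
    (hP : OutputIID P f e) (hf : Measurable f) (he : Measurable e) {α : ENNReal}
    (hΓ : ∀ k : ℕ, b < k → MeasurableSet (Γ k))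
    (hα : ∀ k : ℕ, b < k → α ≤ Measure.pi (fun _ => densityMeasure f) (Γ k)) :
    α * P {w | b < (accepted f e w).card} ≤ P (goodEvent f e b Γ) := by
  have hcard : {w : Fin T → EuclideanSpace ℝ (Fin d) × ℝ | b < (accepted f e w).card} =
      ⋃ k : {k : ℕ // b < k}, {w | (accepted f e w).card = k} := by
    ext w
    simp
  have hdisj : Pairwise (Function.onFun Disjoint fun k : {k : ℕ // b < k} =>
      {w : Fin T → EuclideanSpace ℝ (Fin d) × ℝ |
        ∃ h : (accepted f e w).card = k, output f e w h ∈ Γ k}) :=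
    fun k k' hne => Set.disjoint_left.2 fun w ⟨h, _⟩ ⟨h', _⟩ => hne (Subtype.ext (h.symm.trans h'))
  calc α * P {w | b < (accepted f e w).card}
      ≤ α * ∑' k : {k : ℕ // b < k}, P {w | (accepted f e w).card = k} := by
        rw [hcard]
        gcongr
        exact measure_iUnion_le _
    _ ≤ ∑' k : {k : ℕ // b < k}, P {w | (accepted f e w).card = k} *
          Measure.pi (fun _ => densityMeasure f) (Γ k) := by
        rw [← ENNReal.tsum_mul_left]
        refine ENNReal.tsum_le_tsum fun k => ?_
        rw [mul_comm]
        gcongr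
        exact hα k k.2
    _ = P (goodEvent f e b Γ) := by
        rw [goodEvent_eq_iUnion, measure_iUnion hdisj fun k =>
          measurableSet_output_mem hf he (hΓ k k.2)]
        exact tsum_congr fun k => (hP k _ (hΓ k k.2)).symm

theorem ofReal_one_sub_le {Ω : Type*} [MeasurableSpace Ω] {P : Measure Ω} [IsProbabilityMeasure P]
    {E : Set Ω} {η : ℝ} (h : P.real Eᶜ ≤ η) : ENNReal.ofReal (1 - η) ≤ P E := by
  have hsum : P.real Set.univ ≤ P.real E + P.real Eᶜ := by
    rw [← Set.union_compl_self E]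
    exact measureReal_union_le E Eᶜ
  rw [probReal_univ] at hsum
  rw [← ofReal_measureReal]
  exact ENNReal.ofReal_le_ofReal (by linarith)

theorem IsProposal.isProbabilityMeasure_drawLaw {q : EuclideanSpace ℝ (Fin d) → ℝ} {W : ℝ}
    (hq : IsProposal f q W) (hf : IsDensity f) (m : ℕ) : IsProbabilityMeasure (drawLaw m q) := by
  have := hq.isProbabilityMeasure hf
  unfold drawLaw
  infer_instance

theorem stageOneLaw_real_card_accepted_le_Nbar (hf : IsDensity f) (hg : IsDensity g)
    (hq : IsProposal f g M) (hδ : 0 < δ) (hδ1 : δ ≤ 1) (hT : 0 < initCalls d s n) :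
    (stageOneLaw g s n).real {w | ((accepted f (fun z => M * g z) w).card : ℝ) ≤
      Nbar d s M δ n} ≤ δ ^ 8 := by
  have : (0 : ℝ) < initCalls d s n := by exact_mod_cast hT
  have hL : 0 ≤ Real.log (1 / δ) := Real.log_nonneg (by rwa [le_div_iff₀ hδ, one_mul])
  have h := drawLaw_real_card_accepted_le (m := initCalls d s n) hf hq
    (u := 2 * √(initCalls d s n * Real.log (1 / δ))) (by positivity)
  rw [hg.integral_eq_one, mul_one, ← div_eq_mul_inv] at h
  refine h.trans_eq ?_
  calc Real.exp (-(2 * (2 * √(initCalls d s n * Real.log (1 / δ))) ^ 2 / initCalls d s n))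
      = Real.exp ((8 : ℕ) * Real.log δ) := by
        rw [mul_pow, Real.sq_sqrt (by positivity), one_div, Real.log_inv]
        congr 1
        push_cast
        field_simp
        ring
    _ = δ ^ 8 := by rw [Real.exp_nat_mul, Real.exp_log hδ]

theorem ofReal_mul_le_stageOneLaw_goodEvent (hf : IsDensity f) (hg : IsDensity g)
    (hq : IsProposal f g M) (hδ : 0 < δ) (hδ1 : δ ≤ 1) (hT : 0 < initCalls d s n) {η : ℝ}
    (hη : η ≤ 1) (hΓ : ∀ k : ℕ, Nbar d s M δ n < k → MeasurableSet (Γ k) ∧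
      (Measure.pi fun _ => densityMeasure f).real (Γ k)ᶜ ≤ η) :
    ENNReal.ofReal ((1 - η) * (1 - δ ^ 8)) ≤
      stageOneLaw g s n (goodEvent f (fun z => M * g z) (Nbar d s M δ n) Γ) := by
  have := hf.isProbabilityMeasure
  have : IsProbabilityMeasure (stageOneLaw g s n) := hq.isProbabilityMeasure_drawLaw hf _
  calc ENNReal.ofReal ((1 - η) * (1 - δ ^ 8))
      = ENNReal.ofReal (1 - η) * ENNReal.ofReal (1 - δ ^ 8) :=
        ENNReal.ofReal_mul (sub_nonneg.2 hη)
    _ ≤ ENNReal.ofReal (1 - η) * stageOneLaw g s n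
          {w | Nbar d s M δ n < (accepted f (fun z => M * g z) w).card} := by
        gcongr
        refine ofReal_one_sub_le ((measureReal_mono fun w hw => ?_).trans
          (stageOneLaw_real_card_accepted_le_Nbar hf hg hq hδ hδ1 hT))
        simpa using hw
    _ ≤ _ := (outputIID_drawLaw hf hq).mul_le_goodEvent hf.measurable
        (hq.measurable.const_mul M) (fun k hk => (hΓ k hk).1)
        fun k hk => ofReal_one_sub_le (hΓ k hk).2

end StageOne

/-! ### The pliable proposal -/

section KernelEstimate

variable {d k T : ℕ} {K₀ : ℝ → ℝ} {f g : EuclideanSpace ℝ (Fin d) → ℝ}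
  {s M δ H C C' C'' ε h : ℝ} {w : Fin T → EuclideanSpace ℝ (Fin d) × ℝ}

/-- The kernel density estimate with bandwidth `h` built on the sample `p`. -/
def kernelEstimate (K₀ : ℝ → ℝ) (h : ℝ) (p : Fin k → EuclideanSpace ℝ (Fin d))
    (x : EuclideanSpace ℝ (Fin d)) : ℝ :=
  1 / k * ∑ j, scaledKernel K₀ h x (p j)

/-- The samples of size `k` whose kernel density estimate falls below `f` by at most `H * h ^ s` on
the ball of radius `log k`, where `h` is the bandwidth for `k` samples. -/
def dominatingSamples (K₀ : ℝ → ℝ) (f : EuclideanSpace ℝ (Fin d) → ℝ) (s δ H : ℝ) (k : ℕ) :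
    Set (Fin k → EuclideanSpace ℝ (Fin d)) :=
  {p | ∀ x, ‖x‖ ≤ Real.log k →
    f x ≤ kernelEstimate K₀ (bandwidth d s δ k) p x + H * bandwidth d s δ k ^ s}

/-- `N̂`: the number of samples of the initial stage. -/
abbrev numInitial (f g : EuclideanSpace ℝ (Fin d) → ℝ) (M : ℝ)
    (w : Fin T → EuclideanSpace ℝ (Fin d) × ℝ) : ℕ :=
  (accepted f (fun z => M * g z) w).card

theorem KernelAssumption.integrable_scaledKernel_left (hK : KernelAssumption K₀ C C' C'' ε)
    (hh : 0 < h) (x : EuclideanSpace ℝ (Fin d)) : Integrable fun y => scaledKernel K₀ h y x := by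
  simp_rw [scaledKernel_eq]
  exact ((hK.integrable_prodKernel.comp_smul (inv_ne_zero hh.ne')).comp_sub_left x).const_mul _

theorem KernelAssumption.integral_scaledKernel_left (hK : KernelAssumption K₀ C C' C'' ε)
    (hh : 0 < h) (x : EuclideanSpace ℝ (Fin d)) : ∫ y, scaledKernel K₀ h y x = 1 := by
  have hzero := hK.integral_scaledKernel hh (0 : EuclideanSpace ℝ (Fin d))
  simp_rw [scaledKernel_eq, sub_zero] at hzero ⊢
  rw [← hzero]
  exact integral_sub_left_eq_self (fun u => (h ^ d)⁻¹ * prodKernel K₀ (h⁻¹ • u)) volume x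

theorem KernelAssumption.kernelEstimate_nonneg (hK : KernelAssumption K₀ C C' C'' ε) (hh : 0 < h)
    (p : Fin k → EuclideanSpace ℝ (Fin d)) (x : EuclideanSpace ℝ (Fin d)) :
    0 ≤ kernelEstimate K₀ h p x :=
  mul_nonneg (by positivity) (Finset.sum_nonneg fun _ _ => hK.scaledKernel_nonneg hh _ _)

theorem KernelAssumption.integrable_kernelEstimate (hK : KernelAssumption K₀ C C' C'' ε)
    (hh : 0 < h) (p : Fin k → EuclideanSpace ℝ (Fin d)) : Integrable (kernelEstimate K₀ h p) :=
  (integrable_finsetSum _ fun _ _ => hK.integrable_scaledKernel_left hh _).const_mul _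

theorem KernelAssumption.integral_kernelEstimate_le_one (hK : KernelAssumption K₀ C C' C'' ε)
    (hh : 0 < h) (p : Fin k → EuclideanSpace ℝ (Fin d)) : ∫ x, kernelEstimate K₀ h p x ≤ 1 := by
  simp only [kernelEstimate]
  rw [integral_const_mul, integral_finsetSum _ fun j _ => hK.integrable_scaledKernel_left hh _,
    Finset.sum_congr rfl fun j _ => hK.integral_scaledKernel_left hh (p j), Finset.sum_const,
    Finset.card_univ, Fintype.card_fin, nsmul_eq_mul, mul_one, one_div_mul_eq_div]
  exact div_self_le_one _

theorem sum_accepted_eq_sum_output {e : EuclideanSpace ℝ (Fin d) → ℝ}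
    (h : (accepted f e w).card = k) (φ : EuclideanSpace ℝ (Fin d) → ℝ) :
    ∑ i ∈ accepted f e w, φ (w i).1 = ∑ j, φ (output f e w h j) := by
  rw [← Finset.sum_coe_sort (accepted f e w)]
  exact (((accepted f e w).orderIsoOfFin h).toEquiv.sum_comp
    fun i : accepted f e w => φ (w i).1).symm

theorem fTilde_eq_indicator (K₀ : ℝ → ℝ) (f g : EuclideanSpace ℝ (Fin d) → ℝ) (s M δ : ℝ)
    (w : Fin T → EuclideanSpace ℝ (Fin d) × ℝ) :
    fTilde K₀ f g s M δ w =
      (Metric.closedBall 0 (Real.log (numInitial f g M w))).indicator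
        (kernelEstimate K₀ (bandwidth d s δ (numInitial f g M w))
          (output f (fun z => M * g z) w rfl)) := by
  classical
  ext x
  rw [Set.indicator_apply, mem_closedBall_zero_iff, kernelEstimate, ← sum_accepted_eq_sum_output]
  simp only [fTilde, scaledKernel, ← Finset.mul_sum]
  rw [← mul_assoc, one_div_mul_one_div]

theorem KernelAssumption.fTilde_nonneg (hK : KernelAssumption K₀ C C' C'' ε)
    (hh : 0 < bandwidth d s δ (numInitial f g M w)) (x : EuclideanSpace ℝ (Fin d)) :
    0 ≤ fTilde K₀ f g s M δ w x := by
  rw [fTilde_eq_indicator]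
  exact Set.indicator_nonneg (fun x _ => hK.kernelEstimate_nonneg hh _ x) x

theorem KernelAssumption.integrable_fTilde (hK : KernelAssumption K₀ C C' C'' ε)
    (hh : 0 < bandwidth d s δ (numInitial f g M w)) : Integrable (fTilde K₀ f g s M δ w) := by
  rw [fTilde_eq_indicator]
  exact (hK.integrable_kernelEstimate hh _).indicator measurableSet_closedBall

theorem KernelAssumption.integral_fTilde_le_one (hK : KernelAssumption K₀ C C' C'' ε)
    (hh : 0 < bandwidth d s δ (numInitial f g M w)) : ∫ x, fTilde K₀ f g s M δ w x ≤ 1 := by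
  rw [fTilde_eq_indicator, integral_indicator measurableSet_closedBall]
  exact (setIntegral_le_integral (hK.integrable_kernelEstimate hh _)
    (ae_of_all _ (hK.kernelEstimate_nonneg hh _))).trans (hK.integral_kernelEstimate_le_one hh _)

end KernelEstimate

section Pliable

variable {d n T : ℕ} {K₀ : ℝ → ℝ} {f g : EuclideanSpace ℝ (Fin d) → ℝ}
  {s M δ H C C' C'' ε : ℝ} {w : Fin T → EuclideanSpace ℝ (Fin d) × ℝ}

theorem ballVol_pos (d : ℕ) (hn : 1 < n) : 0 < ballVol d n :=
  ENNReal.toReal_pos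
    (Metric.measure_closedBall_pos volume 0 (Real.log_pos (by exact_mod_cast hn))).ne'
    measure_closedBall_lt_top.ne

theorem rBar_nonneg (hδ : 0 < δ) (hδ1 : δ ≤ 1) (hH : 0 ≤ H) (hN : 1 ≤ Nbar d s M δ n) :
    0 ≤ rBar d s M δ H n := by
  have hlog := (Real.log_nonneg hN).trans (log_le_log_div hδ hδ1 (by linarith))
  exact mul_nonneg (mul_nonneg measureReal_nonneg hH)
    (Real.rpow_nonneg (div_nonneg hlog (by linarith)) _)

theorem one_le_rejConst (hM : 0 ≤ M) (hg : ∀ x, 0 ≤ g x) (hr : 0 ≤ rBar d s M δ H n) :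
    1 ≤ rejConst g s M δ H n := by
  have htail : 0 ≤ M * gBar g s M δ n := mul_nonneg hM (integral_nonneg hg)
  unfold rejConst
  linarith

theorem envelope_eq (hW : rejConst g s M δ H n ≠ 0)
    (w : Fin T → EuclideanSpace ℝ (Fin d) × ℝ) (x : EuclideanSpace ℝ (Fin d)) :
    envelope K₀ f g s M δ H n w x = fTilde K₀ f g s M δ w x
      + (Metric.closedBall 0 (Real.log n)).indicator
          (fun _ => rBar d s M δ H n / ballVol d n) x
      + (Metric.ball 0 (Real.log (Nbar d s M δ n)))ᶜ.indicator (fun z => M * g z) x := by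
  classical
  simp only [envelope, pliable, Set.indicator_apply, Set.mem_compl_iff, mem_ball_zero_iff, not_lt]
  rw [← mul_assoc, mul_one_div_cancel hW, one_mul, mul_ite, mul_one_div, mul_zero]

theorem envelope_nonneg (hK : KernelAssumption K₀ C C' C'' ε) (hM : 0 ≤ M) (hg : ∀ x, 0 ≤ g x)
    (hr : 0 ≤ rBar d s M δ H n) (hh : 0 < bandwidth d s δ (numInitial f g M w))
    (x : EuclideanSpace ℝ (Fin d)) : 0 ≤ envelope K₀ f g s M δ H n w x := by
  rw [envelope_eq (by linarith [one_le_rejConst hM hg hr])]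
  exact add_nonneg
    (add_nonneg (hK.fTilde_nonneg hh x)
      (Set.indicator_nonneg (fun _ _ => div_nonneg hr measureReal_nonneg) x))
    (Set.indicator_nonneg (fun z _ => mul_nonneg hM (hg z)) x)

theorem mul_le_envelope (hK : KernelAssumption K₀ C C' C'' ε) (hM : 0 ≤ M) (hg : ∀ x, 0 ≤ g x)
    (hr : 0 ≤ rBar d s M δ H n) (hh : 0 < bandwidth d s δ (numInitial f g M w))
    {x : EuclideanSpace ℝ (Fin d)} (hx : Real.log (Nbar d s M δ n) ≤ ‖x‖) :
    M * g x ≤ envelope K₀ f g s M δ H n w x := by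
  have hball : 0 ≤ (Metric.closedBall 0 (Real.log n)).indicator
      (fun _ => rBar d s M δ H n / ballVol d n) x :=
    Set.indicator_nonneg (fun _ _ => div_nonneg hr measureReal_nonneg) x
  rw [envelope_eq (by linarith [one_le_rejConst hM hg hr]),
    Set.indicator_of_mem (show x ∈ (Metric.ball 0 _)ᶜ by simpa using hx)]
  linarith [hK.fTilde_nonneg hh x]

theorem kernelEstimate_add_le_envelope (hM : 0 ≤ M) (hg : ∀ x, 0 ≤ g x)
    (hr : 0 ≤ rBar d s M δ H n) {x : EuclideanSpace ℝ (Fin d)}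
    (hxN : ‖x‖ ≤ Real.log (numInitial f g M w)) (hxn : ‖x‖ ≤ Real.log n) :
    kernelEstimate K₀ (bandwidth d s δ (numInitial f g M w))
        (output f (fun z => M * g z) w rfl) x + rBar d s M δ H n / ballVol d n ≤
      envelope K₀ f g s M δ H n w x := by
  rw [envelope_eq (by linarith [one_le_rejConst hM hg hr]), fTilde_eq_indicator,
    Set.indicator_of_mem (mem_closedBall_zero_iff.2 hxN),
    Set.indicator_of_mem (mem_closedBall_zero_iff.2 hxn)]
  exact le_add_of_nonneg_right (Set.indicator_nonneg (fun z _ => mul_nonneg hM (hg z)) x)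

theorem log_div_div_le_log_div_div (hδ : 0 < δ) (hδ1 : δ ≤ 1) {t u : ℝ} (ht : Real.exp 1 ≤ t)
    (htu : t ≤ u) : Real.log (u / δ) / u ≤ Real.log (t / δ) / t := by
  have htδ : Real.exp 1 ≤ t / δ := ht.trans (le_div_self ((Real.exp_pos 1).le.trans ht) hδ hδ1)
  have hle : t / δ ≤ u / δ := by gcongr
  have hanti := Real.log_div_self_antitoneOn (Set.mem_Ici.2 htδ) (Set.mem_Ici.2 (htδ.trans hle)) hle
  have hrescale (v : ℝ) : Real.log (v / δ) / v = 1 / δ * (Real.log (v / δ) / (v / δ)) := by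
    field_simp
  rw [hrescale, hrescale t]
  gcongr

theorem bandwidth_rpow_le {k : ℕ} (hs : 0 ≤ s) (hδ : 0 < δ) (hδ1 : δ ≤ 1)
    (hN : Real.exp 1 ≤ Nbar d s M δ n) (hk : Nbar d s M δ n ≤ k) :
    bandwidth d s δ k ^ s ≤
      (Real.log (Nbar d s M δ n / δ) / Nbar d s M δ n) ^ (s / (2 * s + d)) := by
  have hk1 : (1 : ℝ) ≤ k := (Real.one_le_exp zero_le_one).trans (hN.trans hk)
  have hpos : 0 ≤ Real.log (k / δ) / k :=
    div_nonneg ((Real.log_nonneg hk1).trans (log_le_log_div hδ hδ1 (by linarith))) (by linarith)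
  rw [bandwidth, ← Real.rpow_mul hpos, one_div_mul_eq_div]
  exact Real.rpow_le_rpow hpos (log_div_div_le_log_div_div hδ hδ1 hN hk) (by positivity)

theorem le_envelope (hK : KernelAssumption K₀ C C' C'' ε) (hM : 0 ≤ M) (hg : ∀ x, 0 ≤ g x)
    (hfg : ∀ x, f x ≤ M * g x) (hs : 0 ≤ s) (hδ : 0 < δ) (hδ1 : δ ≤ 1) (hH : 0 ≤ H)
    (hN : Real.exp 1 ≤ Nbar d s M δ n) (hNn : Nbar d s M δ n ≤ n)
    (hk : Nbar d s M δ n ≤ numInitial f g M w)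
    (hh : 0 < bandwidth d s δ (numInitial f g M w))
    (hw : output f (fun z => M * g z) w rfl ∈ dominatingSamples K₀ f s δ H (numInitial f g M w))
    (x : EuclideanSpace ℝ (Fin d)) : f x ≤ envelope K₀ f g s M δ H n w x := by
  have hN1 : 1 < Nbar d s M δ n := (Real.one_lt_exp_iff.2 one_pos).trans_le hN
  have hr := rBar_nonneg hδ hδ1 hH hN1.le
  rcases le_total (Real.log (Nbar d s M δ n)) ‖x‖ with hx | hx
  · exact (hfg x).trans (mul_le_envelope hK hM hg hr hh hx)
  · have hxN := hx.trans (Real.log_le_log (by linarith) hk)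
    have hxn := hx.trans (Real.log_le_log (by linarith) hNn)
    have hV := (ballVol_pos d (by exact_mod_cast hN1.trans_le hNn)).ne'
    calc f x ≤ kernelEstimate K₀ (bandwidth d s δ (numInitial f g M w))
            (output f (fun z => M * g z) w rfl) x +
          H * bandwidth d s δ (numInitial f g M w) ^ s := hw x hxN
      _ ≤ kernelEstimate K₀ (bandwidth d s δ (numInitial f g M w))
            (output f (fun z => M * g z) w rfl) x + rBar d s M δ H n / ballVol d n := by
        rw [rBar, mul_assoc, mul_div_cancel_left₀ _ hV]
        gcongr
        exact bandwidth_rpow_le hs hδ hδ1 hN hk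
      _ ≤ envelope K₀ f g s M δ H n w x := kernelEstimate_add_le_envelope hM hg hr hxN hxn

theorem integral_indicator_closedBall (d : ℕ) (r : ℝ) (hn : 1 < n) :
    ∫ x : EuclideanSpace ℝ (Fin d),
      (Metric.closedBall 0 (Real.log n)).indicator (fun _ => r / ballVol d n) x = r := by
  rw [integral_indicator_const _ measurableSet_closedBall, smul_eq_mul]
  exact mul_div_cancel₀ r (ballVol_pos d hn).ne'

theorem setIntegral_compl_ball (hN : 1 < Nbar d s M δ n)
    (g : EuclideanSpace ℝ (Fin d) → ℝ) :
    ∫ x in (Metric.ball 0 (Real.log (Nbar d s M δ n)))ᶜ, g x = gBar g s M δ n := by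
  refine setIntegral_congr_set (ae_eq_set_compl_compl.2 ?_)
  rw [← Metric.ball_union_sphere]
  exact (union_ae_eq_left_of_ae_eq_empty (ae_eq_empty.2
    (Measure.addHaar_sphere_of_ne_zero volume 0 (Real.log_pos hN).ne'))).symm

theorem integrable_indicator_closedBall_const (d n : ℕ) (r : ℝ) :
    Integrable ((Metric.closedBall (0 : EuclideanSpace ℝ (Fin d)) (Real.log n)).indicator
      fun _ => r) :=
  (integrable_indicator_iff measurableSet_closedBall).2
    (integrableOn_const measure_closedBall_lt_top.ne)

theorem integrable_envelope (hK : KernelAssumption K₀ C C' C'' ε) (hg : Integrable g)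
    (hW : rejConst g s M δ H n ≠ 0) (hh : 0 < bandwidth d s δ (numInitial f g M w)) :
    Integrable (envelope K₀ f g s M δ H n w) := by
  rw [funext (envelope_eq hW w)]
  exact ((hK.integrable_fTilde hh).add
    (integrable_indicator_closedBall_const d n _)).add
      ((hg.const_mul M).indicator measurableSet_ball.compl)

theorem integral_envelope_le (hK : KernelAssumption K₀ C C' C'' ε) (hg : Integrable g)
    (hW : rejConst g s M δ H n ≠ 0) (hh : 0 < bandwidth d s δ (numInitial f g M w))
    (hn : 1 < n) (hN : 1 < Nbar d s M δ n) :
    ∫ x, envelope K₀ f g s M δ H n w x ≤ rejConst g s M δ H n := by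
  have hestimate := hK.integrable_fTilde hh
  have hball := integrable_indicator_closedBall_const d n (rBar d s M δ H n / ballVol d n)
  simp only [envelope_eq hW]
  rw [integral_add (hestimate.fun_add hball) ((hg.const_mul M).indicator measurableSet_ball.compl),
    integral_add hestimate hball, integral_indicator_closedBall d _ hn,
    integral_indicator measurableSet_ball.compl, integral_const_mul, setIntegral_compl_ball hN,
    rejConst]
  gcongr
  exact hK.integral_fTilde_le_one hh

theorem pliable_eq_inv_mul_envelope (hW : rejConst g s M δ H n ≠ 0)
    (w : Fin T → EuclideanSpace ℝ (Fin d) × ℝ) :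
    pliable K₀ f g s M δ H n w =
      fun x => (rejConst g s M δ H n)⁻¹ * envelope K₀ f g s M δ H n w x := by
  ext x
  rw [envelope, inv_mul_cancel_left₀ hW]

theorem integral_pliable_le_one (hK : KernelAssumption K₀ C C' C'' ε) (hM : 0 ≤ M)
    (hg : IsDensity g) (hr : 0 ≤ rBar d s M δ H n)
    (hh : 0 < bandwidth d s δ (numInitial f g M w)) (hn : 1 < n) (hN : 1 < Nbar d s M δ n) :
    ∫ x, pliable K₀ f g s M δ H n w x ≤ 1 := by
  have hW := one_pos.trans_le (one_le_rejConst hM hg.nonneg hr)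
  rw [pliable_eq_inv_mul_envelope hW.ne', integral_const_mul, inv_mul_le_iff₀ hW, mul_one]
  exact integral_envelope_le hK hg.integrable hW.ne' hh hn hN

theorem isProposal_pliable (hK : KernelAssumption K₀ C C' C'' ε) (hε : 0 < ε) (hM : 0 ≤ M)
    (hf : Measurable f) (hg : IsDensity g) (hr : 0 ≤ rBar d s M δ H n)
    (hh : 0 < bandwidth d s δ (numInitial f g M w))
    (hle : ∀ x, f x ≤ envelope K₀ f g s M δ H n w x) :
    IsProposal f (pliable K₀ f g s M δ H n w) (rejConst g s M δ H n) where
  measurable := (measurable_pliable (hK.measurable hε) hf hg.measurable s M δ H n T).of_uncurry_left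
  integrable := by
    have hW := one_pos.trans_le (one_le_rejConst hM hg.nonneg hr)
    rw [pliable_eq_inv_mul_envelope hW.ne']
    exact (integrable_envelope hK hg.integrable hW.ne' hh).const_mul _
  nonneg x := by
    have hW := one_pos.trans_le (one_le_rejConst hM hg.nonneg hr)
    rw [pliable_eq_inv_mul_envelope hW.ne']
    exact mul_nonneg (inv_nonneg.2 hW.le) (envelope_nonneg hK hM hg.nonneg hr hh x)
  pos := one_pos.trans_le (one_le_rejConst hM hg.nonneg hr)
  le_mul := hle

end Pliable

/-! ### Orders of magnitude -/

section Sizes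

variable {d n : ℕ} {f g : EuclideanSpace ℝ (Fin d) → ℝ} {s M δ H a a' : ℝ}

theorem rateExponent_lt_half (d : ℕ) (hs : 0 < s) : s / (3 * s + d) < 1 / 2 := by
  have : (0 : ℝ) ≤ d := Nat.cast_nonneg d
  rw [div_lt_div_iff₀ (by positivity) two_pos]
  linarith

theorem smoothingExponent_le_one (d : ℕ) (hs : 0 < s) : s / (2 * s + d) ≤ 1 := by
  have : (0 : ℝ) ≤ d := Nat.cast_nonneg d
  rw [div_le_one (by positivity)]
  linarith

theorem initCallsExponent_eq (d : ℕ) (hs : 0 < s) :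
    (2 * s + d) / (3 * s + d) = 1 - s / (3 * s + d) := by
  field_simp
  ring

theorem mul_rpow_neg (hn : 1 ≤ n) (q : ℝ) : (n : ℝ) * (n : ℝ) ^ (-q) = (n : ℝ) ^ (1 - q) := by
  rw [sub_eq_add_neg, Real.rpow_add (by exact_mod_cast hn), Real.rpow_one]

theorem rpow_le_initCalls (hs : 0 < s) (n : ℕ) :
    (n : ℝ) ^ (1 - s / (3 * s + d)) ≤ initCalls d s n := by
  rw [← initCallsExponent_eq d hs]
  exact Nat.le_ceil _

theorem initCalls_le (hs : 0 < s) (hn : 1 ≤ n) :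
    (initCalls d s n : ℝ) ≤ 2 * (n * (n : ℝ) ^ (-(s / (3 * s + d)))) := by
  have hn' : (1 : ℝ) ≤ n := by exact_mod_cast hn
  have hceil : (initCalls d s n : ℝ) ≤ (n : ℝ) ^ (1 - s / (3 * s + d)) + 1 := by
    rw [← initCallsExponent_eq d hs]
    exact (Nat.ceil_lt_add_one (by positivity)).le
  have hone : (1 : ℝ) ≤ (n : ℝ) ^ (1 - s / (3 * s + d)) :=
    Real.one_le_rpow hn' (by linarith [rateExponent_lt_half d hs])
  rw [mul_rpow_neg hn]
  linarith

theorem tendsto_initCalls (d : ℕ) (hs : 0 < s) :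
    Tendsto (fun n => (initCalls d s n : ℝ)) atTop atTop :=
  tendsto_atTop_mono (rpow_le_initCalls hs)
    ((tendsto_rpow_atTop (by linarith [rateExponent_lt_half d hs])).comp
      tendsto_natCast_atTop_atTop)

theorem eventually_initCalls_lt (d : ℕ) (hs : 0 < s) : ∀ᶠ n : ℕ in atTop, initCalls d s n < n := by
  have hrate : Tendsto (fun n : ℕ => (n : ℝ) ^ (-(s / (3 * s + d)))) atTop (𝓝 0) :=
    (tendsto_rpow_neg_atTop (by positivity)).comp tendsto_natCast_atTop_atTop
  filter_upwards [hrate.eventually_lt_const (show (0 : ℝ) < 1 / 2 by norm_num),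
    eventually_ge_atTop 1] with n hx hn
  have hn' : (1 : ℝ) ≤ n := by exact_mod_cast hn
  have : (initCalls d s n : ℝ) < n := (initCalls_le hs hn).trans_lt (by nlinarith)
  exact_mod_cast this

theorem div_le_Nbar (hM : 0 < M) (hT : 16 * M ^ 2 * Real.log (1 / δ) ≤ initCalls d s n) :
    (initCalls d s n : ℝ) / (2 * M) ≤ Nbar d s M δ n := by
  rw [Nbar]
  set T := (initCalls d s n : ℝ)
  have hT0 : 0 ≤ T := Nat.cast_nonneg _
  have hsqrt : √(T * Real.log (1 / δ)) ≤ T / (4 * M) := by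
    rw [Real.sqrt_le_left (by positivity), div_pow, le_div_iff₀ (by positivity)]
    nlinarith
  have hsplit : T / M = T / (2 * M) + 2 * (T / (4 * M)) := by
    field_simp
    ring
  linarith

theorem eventually_div_le_Nbar (d : ℕ) (hs : 0 < s) (hM : 0 < M) (δ : ℝ) :
    ∀ᶠ n in atTop, (initCalls d s n : ℝ) / (2 * M) ≤ Nbar d s M δ n :=
  ((tendsto_initCalls d hs).eventually_ge_atTop _).mono fun _ => div_le_Nbar hM

theorem tendsto_Nbar (d : ℕ) (hs : 0 < s) (hM : 0 < M) (δ : ℝ) :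
    Tendsto (Nbar d s M δ) atTop atTop :=
  tendsto_atTop_mono' _ (eventually_div_le_Nbar d hs hM δ)
    ((tendsto_initCalls d hs).atTop_div_const (by positivity))

theorem Nbar_le (hM : 1 ≤ M) (hT : initCalls d s n ≤ n) : Nbar d s M δ n ≤ n := by
  have hdiv : (initCalls d s n : ℝ) / M ≤ initCalls d s n := div_le_self (Nat.cast_nonneg _) hM
  have hT' : (initCalls d s n : ℝ) ≤ n := by exact_mod_cast hT
  rw [Nbar]
  linarith [Real.sqrt_nonneg (initCalls d s n * Real.log (1 / δ))]

theorem inv_Nbar_rpow_le (hs : 0 < s) (hM : 1 ≤ M) (hn : 1 ≤ n)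
    (hN : (initCalls d s n : ℝ) / (2 * M) ≤ Nbar d s M δ n) :
    (Nbar d s M δ n)⁻¹ ^ (s / (2 * s + d)) ≤ 2 * M * (n : ℝ) ^ (-(s / (3 * s + d))) := by
  have hn' : (0 : ℝ) < n := by exact_mod_cast hn
  have hlower : (n : ℝ) ^ (1 - s / (3 * s + d)) / (2 * M) ≤ Nbar d s M δ n := by
    refine le_trans ?_ hN
    gcongr
    exact rpow_le_initCalls hs n
  have hinv : (Nbar d s M δ n)⁻¹ ≤ 2 * M * (n : ℝ) ^ (-(1 - s / (3 * s + d))) := by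
    refine (inv_anti₀ (by positivity) hlower).trans_eq ?_
    rw [inv_div, Real.rpow_neg hn'.le, div_eq_mul_inv]
  have hN0 : 0 ≤ (Nbar d s M δ n)⁻¹ := inv_nonneg.2 (le_trans (by positivity) hlower)
  calc (Nbar d s M δ n)⁻¹ ^ (s / (2 * s + d))
      ≤ (2 * M * (n : ℝ) ^ (-(1 - s / (3 * s + d)))) ^ (s / (2 * s + d)) :=
        Real.rpow_le_rpow hN0 hinv (by positivity)
    _ = (2 * M) ^ (s / (2 * s + d)) * (n : ℝ) ^ (-(s / (3 * s + d))) := by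
        rw [Real.mul_rpow (by positivity) (by positivity), ← Real.rpow_mul hn'.le]
        congr 2
        field_simp
        ring
    _ ≤ 2 * M * (n : ℝ) ^ (-(s / (3 * s + d))) := by
        gcongr
        exact Real.rpow_le_self_of_one_le (by linarith) (smoothingExponent_le_one d hs)

/-- The rate `log (n / δ) ^ (d + 1) * n ^ (-s / (3 * s + d))` at which the proportion of rejected
points tends to `0`. -/
def rejectionRate (d : ℕ) (s δ : ℝ) (n : ℕ) : ℝ :=
  Real.log (n / δ) ^ (d + 1) * (n : ℝ) ^ (-(s / (3 * s + d)))

theorem rpow_neg_le_rejectionRate (hlog : 1 ≤ Real.log (n / δ)) :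
    (n : ℝ) ^ (-(s / (3 * s + d))) ≤ rejectionRate d s δ n :=
  le_mul_of_one_le_left (by positivity) (one_le_pow₀ hlog)

theorem ballVol_eq (d : ℕ) (hn : 1 ≤ n) : ballVol d n =
    Real.log n ^ d * volume.real (Metric.ball (0 : EuclideanSpace ℝ (Fin d)) 1) := by
  rw [ballVol, Measure.addHaar_real_closedBall _ _ (Real.log_nonneg (by exact_mod_cast hn)),
    finrank_euclideanSpace_fin]

theorem rBar_le (hs : 0 < s) (hM : 1 ≤ M) (hH : 0 ≤ H) (hδ : 0 < δ) (hδ1 : δ ≤ 1)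
    (hT : initCalls d s n ≤ n) (hN : (initCalls d s n : ℝ) / (2 * M) ≤ Nbar d s M δ n)
    (hN1 : 1 ≤ Nbar d s M δ n) (hlog : 1 ≤ Real.log (n / δ)) :
    rBar d s M δ H n ≤ 2 * M * H * volume.real (Metric.ball (0 : EuclideanSpace ℝ (Fin d)) 1) *
      rejectionRate d s δ n := by
  have hNn := Nbar_le (δ := δ) hM hT
  have hn : 1 ≤ n := by exact_mod_cast hN1.trans hNn
  have hinv := inv_Nbar_rpow_le hs hM hn hN
  set N := Nbar d s M δ n
  set V := volume.real (Metric.ball (0 : EuclideanSpace ℝ (Fin d)) 1)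
  have hN0 : 0 < N := by linarith
  have hlogN : 0 ≤ Real.log (N / δ) := (Real.log_nonneg hN1).trans (log_le_log_div hδ hδ1 hN0)
  have hlogn : Real.log n ≤ Real.log (n / δ) := log_le_log_div hδ hδ1 (by linarith)
  have : 0 ≤ Real.log n := Real.log_natCast_nonneg n
  have hpow : Real.log (N / δ) ^ (s / (2 * s + d)) ≤ Real.log (n / δ) :=
    calc Real.log (N / δ) ^ (s / (2 * s + d)) ≤ Real.log (n / δ) ^ (s / (2 * s + d)) := by gcongr
      _ ≤ Real.log (n / δ) := Real.rpow_le_self_of_one_le hlog (smoothingExponent_le_one d hs)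
  calc rBar d s M δ H n
      = Real.log n ^ d * V * H *
          (Real.log (N / δ) ^ (s / (2 * s + d)) * N⁻¹ ^ (s / (2 * s + d))) := by
        rw [rBar, ballVol_eq d hn, div_eq_mul_inv, Real.mul_rpow hlogN (by positivity)]
    _ ≤ Real.log (n / δ) ^ d * V * H *
          (Real.log (n / δ) * (2 * M * (n : ℝ) ^ (-(s / (3 * s + d))))) := by gcongr
    _ = 2 * M * H * V * rejectionRate d s δ n := by
        rw [rejectionRate]
        ring

theorem integrable_exp_neg_mul_norm_sq (d : ℕ) {b : ℝ} (hb : 0 < b) :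
    Integrable fun x : EuclideanSpace ℝ (Fin d) => Real.exp (-b * ‖x‖ ^ 2) := by
  have hcomplex := (GaussianFourier.integrable_cexp_neg_mul_sq_norm_add (b := (b : ℂ))
    (V := EuclideanSpace ℝ (Fin d)) (by simpa using hb) 0 0).norm
  refine hcomplex.congr (ae_of_all _ fun x => ?_)
  simp only [Complex.norm_exp]
  congr 1
  simp [← Complex.ofReal_pow]

theorem exp_neg_mul_sq_le {t x : ℝ} (ha' : 0 ≤ a') (ht : 1 ≤ t) (hat : 2 ≤ a' * Real.log t)
    (hx : Real.log t ≤ x) :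
    Real.exp (-a' * x ^ 2) ≤ t⁻¹ * Real.exp (-(a' / 2) * x ^ 2) := by
  have hlog : 0 ≤ Real.log t := Real.log_nonneg ht
  have hexponent : -a' * x ^ 2 ≤ -Real.log t + -(a' / 2) * x ^ 2 := by
    have hsq : a' * Real.log t ^ 2 ≤ a' * x ^ 2 := by gcongr
    nlinarith
  calc Real.exp (-a' * x ^ 2) ≤ Real.exp (-Real.log t + -(a' / 2) * x ^ 2) :=
        Real.exp_le_exp.2 hexponent
    _ = t⁻¹ * Real.exp (-(a' / 2) * x ^ 2) := by
        rw [Real.exp_add, Real.exp_neg, Real.exp_log (by linarith)]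

theorem gBar_le (hg : ProposalAssumption f g M a a') (ha : 0 ≤ a) (ha' : 0 < a')
    (hN1 : 1 ≤ Nbar d s M δ n) (hN : 2 ≤ a' * Real.log (Nbar d s M δ n)) :
    gBar g s M δ n ≤ a * (∫ x : EuclideanSpace ℝ (Fin d), Real.exp (-(a' / 2) * ‖x‖ ^ 2)) *
      (Nbar d s M δ n)⁻¹ := by
  have hgauss := integrable_exp_neg_mul_norm_sq d (half_pos ha')
  unfold gBar
  set N := Nbar d s M δ n
  have htail : ∀ x ∈ (Metric.closedBall (0 : EuclideanSpace ℝ (Fin d)) (Real.log N))ᶜ,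
      g x ≤ a * (N⁻¹ * Real.exp (-(a' / 2) * ‖x‖ ^ 2)) := fun x hx => by
    rw [Set.mem_compl_iff, mem_closedBall_zero_iff, not_le] at hx
    exact (hg.subGaussian x).trans
      (mul_le_mul_of_nonneg_left (exp_neg_mul_sq_le ha'.le hN1 hN hx.le) ha)
  calc ∫ x in (Metric.closedBall (0 : EuclideanSpace ℝ (Fin d)) (Real.log N))ᶜ, g x
      ≤ ∫ x in (Metric.closedBall (0 : EuclideanSpace ℝ (Fin d)) (Real.log N))ᶜ,
          a * (N⁻¹ * Real.exp (-(a' / 2) * ‖x‖ ^ 2)) :=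
        setIntegral_mono_on hg.isDensity.integrable.integrableOn
          ((hgauss.const_mul _).const_mul _).integrableOn measurableSet_closedBall.compl htail
    _ ≤ ∫ x : EuclideanSpace ℝ (Fin d), a * (N⁻¹ * Real.exp (-(a' / 2) * ‖x‖ ^ 2)) :=
        setIntegral_le_integral ((hgauss.const_mul _).const_mul _)
          (ae_of_all _ fun x => mul_nonneg ha (by positivity))
    _ = a * (∫ x : EuclideanSpace ℝ (Fin d), Real.exp (-(a' / 2) * ‖x‖ ^ 2)) * N⁻¹ := by
        rw [integral_const_mul, integral_const_mul]
        ring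

/-- The constant in the bound on `rejConst`: the first summand comes from `rBar`, the second one
from `gBar`. -/
def rejectionConst (d : ℕ) (M H a a' : ℝ) : ℝ :=
  2 * M * H * volume.real (Metric.ball (0 : EuclideanSpace ℝ (Fin d)) 1) +
    M * (a * (∫ x : EuclideanSpace ℝ (Fin d), Real.exp (-(a' / 2) * ‖x‖ ^ 2)) * (2 * M))

theorem integral_exp_nonneg (φ : EuclideanSpace ℝ (Fin d) → ℝ) : 0 ≤ ∫ x, Real.exp (φ x) :=
  integral_nonneg fun _ => (Real.exp_pos _).le

theorem rejectionConst_nonneg (d : ℕ) (hM : 0 ≤ M) (hH : 0 ≤ H) (ha : 0 ≤ a) (a' : ℝ) :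
    0 ≤ rejectionConst d M H a a' := by
  have := integral_exp_nonneg fun x : EuclideanSpace ℝ (Fin d) => -(a' / 2) * ‖x‖ ^ 2
  unfold rejectionConst
  positivity

theorem rejConst_le (hs : 0 < s) (hM : 1 ≤ M) (hH : 0 ≤ H) (hδ : 0 < δ) (hδ1 : δ ≤ 1)
    (hg : ProposalAssumption f g M a a') (ha : 0 ≤ a) (ha' : 0 < a') (hT : initCalls d s n ≤ n)
    (hN : (initCalls d s n : ℝ) / (2 * M) ≤ Nbar d s M δ n) (hN1 : 1 ≤ Nbar d s M δ n)
    (hN2 : 2 ≤ a' * Real.log (Nbar d s M δ n)) (hlog : 1 ≤ Real.log (n / δ)) :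
    rejConst g s M δ H n ≤ 1 + rejectionConst d M H a a' * rejectionRate d s δ n := by
  have hn : 1 ≤ n := by exact_mod_cast hN1.trans (Nbar_le hM hT)
  have := integral_exp_nonneg fun x : EuclideanSpace ℝ (Fin d) => -(a' / 2) * ‖x‖ ^ 2
  have hinv : (Nbar d s M δ n)⁻¹ ≤ 2 * M * rejectionRate d s δ n :=
    calc (Nbar d s M δ n)⁻¹ ≤ (Nbar d s M δ n)⁻¹ ^ (s / (2 * s + d)) :=
          Real.self_le_rpow_of_le_one (by positivity) (inv_le_one_of_one_le₀ hN1)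
            (smoothingExponent_le_one d hs)
      _ ≤ 2 * M * (n : ℝ) ^ (-(s / (3 * s + d))) := inv_Nbar_rpow_le hs hM hn hN
      _ ≤ 2 * M * rejectionRate d s δ n := by
          gcongr
          exact rpow_neg_le_rejectionRate hlog
  have htail : M * gBar g s M δ n ≤
      M * (a * (∫ x : EuclideanSpace ℝ (Fin d), Real.exp (-(a' / 2) * ‖x‖ ^ 2)) *
        (2 * M * rejectionRate d s δ n)) := by
    gcongr
    exact (gBar_le hg ha ha' hN1 hN2).trans (by gcongr)
  rw [rejConst, rejectionConst]
  linarith [rBar_le hs hM hH hδ hδ1 hT hN hN1 hlog]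

theorem mul_one_sub_le {T : ℕ} {W Λ κ x : ℝ} (hTn : T ≤ n) (hT : (T : ℝ) ≤ 2 * (n * x))
    (hW1 : 1 ≤ W) (hW : W ≤ 1 + κ * Λ) (hxΛ : x ≤ Λ) :
    (n : ℝ) * (1 - (κ + 3) * Λ) ≤ ((n - T : ℕ) : ℝ) * W⁻¹ - n * x := by
  have hTn' : (T : ℝ) ≤ n := by exact_mod_cast hTn
  have hinv : 1 - κ * Λ ≤ W⁻¹ := by
    rw [← one_div, le_div_iff₀ (by linarith)]
    nlinarith [sq_nonneg (W - 1)]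
  have hdraws : ((n : ℝ) - T) * (1 - κ * Λ) ≤ (n - T) * W⁻¹ := by gcongr
  have hcalls : 0 ≤ T * (κ * Λ) := mul_nonneg (Nat.cast_nonneg T) (by linarith)
  have hrate : (n : ℝ) * x ≤ n * Λ := by gcongr
  rw [Nat.cast_sub hTn]
  nlinarith

theorem eventually_exp_neg_sq_div_le (d : ℕ) (hs : 0 < s) {η : ℝ} (hη : 0 < η) :
    ∀ᶠ n : ℕ in atTop, ∀ m : ℕ, 0 < m → m ≤ n →
      Real.exp (-(2 * (n * (n : ℝ) ^ (-(s / (3 * s + d)))) ^ 2 / m)) ≤ η := by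
  have hpow : Tendsto (fun n : ℕ => (n : ℝ) ^ (1 - 2 * (s / (3 * s + d)))) atTop atTop :=
    (tendsto_rpow_atTop (by linarith [rateExponent_lt_half d hs])).comp
      tendsto_natCast_atTop_atTop
  filter_upwards [hpow.eventually_ge_atTop (-Real.log η / 2), eventually_ge_atTop 1]
    with n hn hn1 m hm hmn
  have hn' : (0 : ℝ) < n := by exact_mod_cast hn1
  have hsq : (n : ℝ) ^ (1 - 2 * (s / (3 * s + d))) =
      (n * (n : ℝ) ^ (-(s / (3 * s + d)))) ^ 2 / n := by
    rw [mul_rpow_neg hn1, ← Real.rpow_natCast, ← Real.rpow_mul hn'.le,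
      ← Real.rpow_sub_one hn'.ne']
    congr 1
    push_cast
    ring
  have hle : (n * (n : ℝ) ^ (-(s / (3 * s + d)))) ^ 2 / n ≤
      (n * (n : ℝ) ^ (-(s / (3 * s + d)))) ^ 2 / m := by gcongr
  rw [← Real.le_log_iff_exp_le hη, mul_div_assoc]
  linarith

end Sizes

/-! ### The two stages -/

section Stages

variable {d n : ℕ} {K₀ : ℝ → ℝ} {f g : EuclideanSpace ℝ (Fin d) → ℝ}
  {s C C' C'' ε c c' c'' a a' M δ η H : ℝ}

theorem ProposalAssumption.isProposal (hg : ProposalAssumption f g M a a') (hM : 0 < M) :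
    IsProposal f g M where
  measurable := hg.isDensity.measurable
  integrable := hg.isDensity.integrable
  nonneg := hg.isDensity.nonneg
  pos := hM
  le_mul := hg.le_mul

theorem ProposalAssumption.one_le (hg : ProposalAssumption f g M a a') (hM : 0 < M)
    (hf : IsDensity f) : 1 ≤ M := by
  simpa only [hg.isDensity.integral_eq_one, mul_one] using
    hf.one_le_mul_integral (hg.isProposal hM)

theorem log_div_pos {x : ℝ} (hδ : 0 < δ) (hδ1 : δ ≤ 1) (hx : 1 < x) : 0 < Real.log (x / δ) :=
  (Real.log_pos hx).trans_le (log_le_log_div hδ hδ1 (by linarith))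

theorem eventually_exists_subset_dominatingSamples (hd : 1 ≤ d) (hs : 0 < s) (hs2 : s ≤ 2)
    (hC : 0 < C) (hC' : 0 ≤ C') (hC'' : 0 < C'') (hε : 0 < ε) (hc : 0 < c) (hc' : 0 ≤ c')
    (hc'' : 0 ≤ c'') (hH : H₁ d s ε c c'' C C' C'' ≤ H) (hδ : 0 < δ) (hδ1 : δ ≤ 1)
    (hη : 0 < η) :
    ∀ᶠ k : ℕ in atTop, ∀ (K₀ : ℝ → ℝ) (f : EuclideanSpace ℝ (Fin d) → ℝ),
      KernelAssumption K₀ C C' C'' ε → TargetAssumption f s c c' c'' →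
      ∃ G, MeasurableSet G ∧ (Measure.pi fun _ => densityMeasure f).real Gᶜ ≤ η ∧
        G ⊆ dominatingSamples K₀ f s δ H k := by
  have hHle := (uniformConst_le_H₁ hd hs hε hC.le hC' hC''.le hc.le hc'').trans hH
  filter_upwards [eventually_exists_uniform_event hd hs hs2 hC hC'' hε hc hc' hc'' hδ hδ1 hη,
    eventually_gt_atTop 1] with k hk hk1 K₀ f hK hf
  have := bandwidth_pos (d := d) (s := s) (one_pos.trans hk1)
    (log_div_pos hδ hδ1 (by exact_mod_cast hk1))
  obtain ⟨G, hG, hprob, hle⟩ := hk K₀ f hK hf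
  refine ⟨G, hG, hprob, fun p hp x hx => (hle p hp x hx).trans ?_⟩
  rw [kernelEstimate]
  gcongr

theorem isProposal_pliable_of_mem_goodEvent (hK : KernelAssumption K₀ C C' C'' ε) (hε : 0 < ε)
    (hf : Measurable f) (hg : IsDensity g) (hM : 0 ≤ M) (hfg : ∀ x, f x ≤ M * g x) (hs : 0 ≤ s)
    (hδ : 0 < δ) (hδ1 : δ ≤ 1) (hH : 0 ≤ H) (hN : Real.exp 1 ≤ Nbar d s M δ n)
    (hNn : Nbar d s M δ n ≤ n) {Γ : ∀ k : ℕ, Set (Fin k → EuclideanSpace ℝ (Fin d))}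
    (hΓ : ∀ k, Γ k ⊆ dominatingSamples K₀ f s δ H k) {T : ℕ}
    {w : Fin T → EuclideanSpace ℝ (Fin d) × ℝ}
    (hw : w ∈ goodEvent f (fun z => M * g z) (Nbar d s M δ n) Γ) :
    IsProposal f (pliable K₀ f g s M δ H n w) (rejConst g s M δ H n) ∧
      ∫ x, pliable K₀ f g s M δ H n w x ≤ 1 := by
  obtain ⟨hk, hout⟩ := hw
  have hN1 : 1 < Nbar d s M δ n := (Real.one_lt_exp_iff.2 one_pos).trans_le hN
  have hn : 1 < n := by exact_mod_cast hN1.trans_le hNn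
  have hr := rBar_nonneg hδ hδ1 hH hN1.le
  have hk1 : (1 : ℝ) < numInitial f g M w := hN1.trans hk
  have hh := bandwidth_pos (d := d) (s := s) (by exact_mod_cast one_pos.trans hk1)
    (log_div_pos hδ hδ1 hk1)
  exact ⟨isProposal_pliable hK hε hM hf hg hr hh
      (le_envelope hK hM hg.nonneg hfg hs hδ hδ1 hH hN hNn hk.le hh (hΓ _ hout)),
    integral_pliable_le_one hK hM hg hr hh hn hN1⟩

theorem eventually_exists_initial_event (hd : 1 ≤ d) (hs : 0 < s) (hs2 : s ≤ 2) (hC : 0 < C)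
    (hC' : 0 ≤ C') (hC'' : 0 < C'') (hε : 0 < ε) (hc : 0 < c) (hc' : 0 ≤ c') (hc'' : 0 ≤ c'')
    (hM : 0 < M) (hH : 0 ≤ H) (hH₁ : H₁ d s ε c c'' C C' C'' ≤ H) (hδ : 0 < δ) (hδ1 : δ ≤ 1)
    (hη : 0 < η) (hη1 : η ≤ 1) :
    ∀ᶠ n in atTop, ∀ (K₀ : ℝ → ℝ) (f g : EuclideanSpace ℝ (Fin d) → ℝ),
      KernelAssumption K₀ C C' C'' ε → TargetAssumption f s c c' c'' →
      ProposalAssumption f g M a a' →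
      ∃ G, MeasurableSet G ∧ ENNReal.ofReal ((1 - η) * (1 - δ ^ 8)) ≤ stageOneLaw g s n G ∧
        ∀ w ∈ G, IsProposal f (pliable K₀ f g s M δ H n w) (rejConst g s M δ H n) ∧
          ∫ x, pliable K₀ f g s M δ H n w x ≤ 1 := by
  obtain ⟨k₀, hk₀⟩ := eventually_atTop.1 (eventually_exists_subset_dominatingSamples hd hs hs2 hC
    hC' hC'' hε hc hc' hc'' hH₁ hδ hδ1 hη)
  filter_upwards [(tendsto_initCalls d hs).eventually_gt_atTop 0, eventually_initCalls_lt d hs,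
    (tendsto_Nbar d hs hM δ).eventually_ge_atTop (Real.exp 1),
    (tendsto_Nbar d hs hM δ).eventually_ge_atTop k₀] with n hT hTn hN hNk K₀ f g hK hf hg
  have hsamples (k : ℕ) : ∃ Γ : Set (Fin k → EuclideanSpace ℝ (Fin d)),
      Γ ⊆ dominatingSamples K₀ f s δ H k ∧ (Nbar d s M δ n < k →
        MeasurableSet Γ ∧ (Measure.pi fun _ => densityMeasure f).real Γᶜ ≤ η) := by
    by_cases hk : Nbar d s M δ n < k
    · obtain ⟨Γ, hΓ, hprob, hsub⟩ := hk₀ k (by exact_mod_cast hNk.trans hk.le) K₀ f hK hf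
      exact ⟨Γ, hsub, fun _ => ⟨hΓ, hprob⟩⟩
    · exact ⟨∅, Set.empty_subset _, fun h => absurd h hk⟩
  choose Γ hsub hΓ using hsamples
  exact ⟨goodEvent f (fun z => M * g z) (Nbar d s M δ n) Γ,
    measurableSet_goodEvent hf.isDensity.measurable (hg.isDensity.measurable.const_mul M)
      fun k hk => (hΓ k hk).1,
    ofReal_mul_le_stageOneLaw_goodEvent hf.isDensity hg.isDensity (hg.isProposal hM) hδ hδ1
      (by exact_mod_cast hT) hη1 hΓ,
    fun w hw => isProposal_pliable_of_mem_goodEvent hK hε hf.isDensity.measurable hg.isDensity hM.le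
      hg.le_mul hs.le hδ hδ1 hH hN (Nbar_le (hg.one_le hM hf.isDensity) hTn.le) hsub hw⟩

theorem IsProposal.ofReal_one_sub_le_drawLaw {q : EuclideanSpace ℝ (Fin d) → ℝ} {W t u : ℝ}
    {m : ℕ} (hq : IsProposal f q W) (hf : IsDensity f) (hu : 0 ≤ u)
    (ht : t ≤ m * (W * ∫ x, q x)⁻¹ - u) (hη : Real.exp (-(2 * u ^ 2 / m)) ≤ η) :
    ENNReal.ofReal (1 - η) ≤ drawLaw m q {y | t ≤ (accepted f (fun x => W * q x) y).card} := by
  have := hq.isProbabilityMeasure_drawLaw hf m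
  refine ofReal_one_sub_le (le_trans (measureReal_mono fun y hy => ?_)
    ((drawLaw_real_card_accepted_le hf hq hu).trans hη))
  exact (not_le.1 fun h => hy h).le.trans ht

theorem eventually_ofReal_one_sub_le_stageTwoLaw (hs : 0 < s) (hM : 0 < M) (hH : 0 ≤ H)
    (hδ : 0 < δ) (hδ1 : δ ≤ 1) (ha : 0 ≤ a) (ha' : 0 < a') (hη : 0 < η) :
    ∀ᶠ n : ℕ in atTop, ∀ (K₀ : ℝ → ℝ) (f g : EuclideanSpace ℝ (Fin d) → ℝ), IsDensity f →
      ProposalAssumption f g M a a' → ∀ w : Fin (initCalls d s n) → EuclideanSpace ℝ (Fin d) × ℝ,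
      IsProposal f (pliable K₀ f g s M δ H n w) (rejConst g s M δ H n) →
      ∫ x, pliable K₀ f g s M δ H n w x ≤ 1 →
      ENNReal.ofReal (1 - η) ≤ stageTwoLaw K₀ f g s M δ H n w
        {y | n * (1 - (rejectionConst d M H a a' + 3) * rejectionRate d s δ n) ≤
          (accepted f (envelope K₀ f g s M δ H n w) y).card} := by
  have hNbar := tendsto_Nbar d hs hM δ
  filter_upwards [eventually_initCalls_lt d hs, eventually_div_le_Nbar d hs hM δ,
    hNbar.eventually_ge_atTop 1,
    ((Real.tendsto_log_atTop.comp hNbar).const_mul_atTop ha').eventually_ge_atTop 2,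
    eventually_exp_neg_sq_div_le d hs hη, eventually_ge_atTop 3]
    with n hT hN hN1 hN2 hexp hn K₀ f g hf hg w hq hmass
  have hlog : 1 ≤ Real.log (n / δ) := (one_le_log hn).trans (log_le_log_div hδ hδ1 (by positivity))
  have hW1 := one_le_rejConst hM.le hg.isDensity.nonneg (rBar_nonneg hδ hδ1 hH hN1)
  have hW := rejConst_le hs (hg.one_le hM hf) hH hδ hδ1 hg ha ha' hT.le hN hN1 hN2 hlog
  have hrate : (rejConst g s M δ H n)⁻¹ ≤
      (rejConst g s M δ H n * ∫ x, pliable K₀ f g s M δ H n w x)⁻¹ :=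
    inv_anti₀ (mul_pos hq.pos (hq.integral_pos hf)) (mul_le_of_le_one_right hq.pos.le hmass)
  refine hq.ofReal_one_sub_le_drawLaw hf (u := n * (n : ℝ) ^ (-(s / (3 * s + d)))) (by positivity)
    ?_ (hexp _ (Nat.sub_pos_of_lt hT) (Nat.sub_le _ _))
  refine (mul_one_sub_le hT.le (initCalls_le hs (by lia)) hW1 hW
    (rpow_neg_le_rejectionRate hlog)).trans ?_
  gcongr

theorem one_sub_le_mul_one_sub {p : ℝ} (hp : 0 ≤ p) (hpδ : p ≤ δ) (hδ1 : δ ≤ 1) :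
    1 - δ ≤ (1 - (δ - p) / 2) * ((1 - (δ - p) / 2) * (1 - p)) := by
  have hη : 0 ≤ (δ - p) / 2 := by linarith
  have hcross : 0 ≤ (δ - p) / 2 * p * (2 - (δ - p) / 2) :=
    mul_nonneg (mul_nonneg hη hp) (by linarith)
  nlinarith [sq_nonneg ((δ - p) / 2)]

end Stages

end EPRS

end

theorem theorem4 (d : ℕ) (hd : 1 ≤ d) (s : ℝ) (hs : 0 < s) (hs2 : s ≤ 2)
    (C C' C'' ε c c' c'' a a' M H : ℝ)
    (hC : 0 < C) (hC' : 0 < C') (hC'' : 0 < C'') (hε : 0 < ε)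
    (hc : 0 < c) (hc' : 0 < c') (hc'' : 0 < c'') (ha : 0 < a) (ha' : 0 < a') (hM : 0 < M)
    (hH : 0 < H) (hH₁ : EPRS.H₁ d s ε c c'' C C' C'' ≤ H) :
    ∃ κ : ℝ, 0 < κ ∧ ∀ δ : ℝ, 0 < δ → δ < 1 → ∃ n₀ : ℕ, ∀ n : ℕ, n₀ ≤ n →
      ∀ (K₀ : ℝ → ℝ) (f g : EuclideanSpace ℝ (Fin d) → ℝ),
        EPRS.KernelAssumption K₀ C C' C'' ε →
        EPRS.TargetAssumption f s c c' c'' →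
        EPRS.ProposalAssumption f g M a a' →
        ∃ G : Set (Fin (EPRS.initCalls d s n) → EuclideanSpace ℝ (Fin d) × ℝ),
          MeasurableSet G ∧
          (∀ w ∈ G, EPRS.OutputIID (EPRS.stageTwoLaw K₀ f g s M δ H n w) f
            (EPRS.envelope K₀ f g s M δ H n w)) ∧
          ENNReal.ofReal (1 - δ) ≤ EPRS.runLaw K₀ f g s M δ H n
            {ω | ω.1 ∈ G ∧
              (n : ℝ) * (1 - κ * Real.log (n / δ) ^ (d + 1) * (n : ℝ) ^ (-(s / (3 * s + d))))
                ≤ EPRS.numOutput K₀ f g s M δ H n ω} := by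
  refine ⟨EPRS.rejectionConst d M H a a' + 3,
    by linarith [EPRS.rejectionConst_nonneg d hM.le hH.le ha.le a'],
    fun δ hδ hδ1 => Filter.eventually_atTop.1 ?_⟩
  -- The initial stage accepts at most `N̄` points with probability at most `δ ^ 8`. The rest of `δ`
  -- is split evenly between the failures of the kernel estimate and of the second stage.
  have hδ8 : δ ^ 8 < δ := pow_lt_self_of_lt_one₀ hδ hδ1 (by norm_num)
  have hδ8' : 0 < δ ^ 8 := by positivity
  let η := (δ - δ ^ 8) / 2
  have hη : 0 < η := half_pos (sub_pos.2 hδ8)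
  have hη1 : (δ - δ ^ 8) / 2 ≤ 1 := by linarith
  filter_upwards [EPRS.eventually_exists_initial_event hd hs hs2 hC hC'.le hC'' hε hc hc'.le hc''.le
      hM hH.le hH₁ hδ hδ1.le hη hη1,
    EPRS.eventually_ofReal_one_sub_le_stageTwoLaw hs hM hH.le hδ hδ1.le ha.le ha' hη]
    with n hinitial hfinal K₀ f g hK hf hg
  obtain ⟨G, hG, hprob, hpliable⟩ := hinitial K₀ f g hK hf hg
  refine ⟨G, hG, fun w hw => EPRS.outputIID_drawLaw hf.isDensity (hpliable w hw).1, ?_⟩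
  calc ENNReal.ofReal (1 - δ) ≤ ENNReal.ofReal ((1 - η) * ((1 - η) * (1 - δ ^ 8))) :=
        ENNReal.ofReal_le_ofReal (EPRS.one_sub_le_mul_one_sub hδ8'.le hδ8.le hδ1.le)
    _ ≤ ENNReal.ofReal (1 - η) * EPRS.stageOneLaw g s n G := by
        rw [ENNReal.ofReal_mul (sub_nonneg.2 hη1)]
        gcongr
    _ ≤ _ := EPRS.mul_le_runLaw (hK.measurable hε) hf.isDensity.measurable hg.isDensity.measurable
        hG fun w hw => by
          simpa only [EPRS.rejectionRate, mul_assoc] using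
            hfinal K₀ f g hf.isDensity hg w (hpliable w hw).1 (hpliable w hw).2
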